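/- **Conventions.** Semirings are commutative and additively idempotent, ordered by $a\ge b\iff a+b=a$. Let $\mathbb T=(\mathbb R\cup\{-\infty\},\max,+)$, and let $S\subseteq\mathbb T$ be a sub-semifield different from the Boolean semifield $\mathbb B=\{0,1\}$. A totally ordered semifield $K$ carries the topology with base the sets $\{a\}$ and $[0_K,a]$, $a\in K^\times$. A proper congruence $P$ on a semiring $A$ is *prime* if $A/P$ is totally ordered and cancellative; $\kappa(P)$ is the semifield of fractions of $A/P$ and $a\mapsto|a|_P$ is the canonical map $A\to\kappa(P)$. For a topological semiring $A$, $\operatorname{Cont}A$ is the set of primes $P$ on $A$ with $A/P\ne\mathbb B$ for which $A\to\kappa(P)$ is continuous. For an $S$-algebra $A$, $\operatorname{Cont}_SA$ is $\operatorname{Cont}A$ for the topology on $A$ generated by the initial topologies of all semiring homomorphisms $A\to B$ to (not necessarily idempotent) topological semirings $B$ with $S\to A\to B$ continuous; $\operatorname{Cont}^\circ_SA$ consists of the $P\in\operatorname{Cont}_SA$ for which $(a,0)\in P$ only if $a=0$. Let $\Lambda$ be a finitely generated free abelian group, $N_{\mathbb R}=\operatorname{Hom}(\Lambda,\mathbb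 R)$, $\sigma\subset N_{\mathbb R}$ a strongly convex rational polyhedral cone, and $M=\sigma^\vee\cap\Lambda=\{u\in\Lambda:\langle v,u\rangle\le0\text{ for all }v\in\sigma\}$. Let $N_{\mathbb R}(\sigma)=\operatorname{Hom}(M,(\mathbb T,\cdot))$ be the set of monoid homomorphisms, topologized as a subspace of the product $\mathbb T^M$ with $\mathbb T\cong[0,\infty)$ via $\exp$, and with the pointwise operation, written $+_{\mathbb R}$. Each $v\in N_{\mathbb R}$ gives the point $u\mapsto\langle v,u\rangle$ of $N_{\mathbb R}(\sigma)$; let $\bar\sigma$ be the closure in $N_{\mathbb R}(\sigma)$ of the image of $\sigma$. For $P\in\operatorname{Cont}^\circ_SS[M]$ let $S\langle M\rangle_P$ be the set of series $f=\sum_{u\in M}f_u\chi^u$ with coefficients in $S$ such that $\{u:|f_u\chi^u|_P\ge b\}$ is finite for every nonzero $b\in S[M]/P$. It is a semiring under termwise addition and the product with coefficients $\max_{v+w=u}f_vg_w$, and is topologized by the balls $\{g: d_P(g,f)<r\}$, $r\in\kappa(P)^\times$, where $d_P(f,g)=\max_{f_u\ne g_u}|(f_u+g_u)\chi^u|_P\in\kappa(P)$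 (and $d_P(f,f)=0$). Let $\iota:S[M]\to S\langle M\rangle_P$ be the inclusion. For $P'\in\operatorname{Cont}_SS[M]$, the point $\Phi(P')\in N_{\mathbb R}(\sigma)$ is the composition $M\to S[M]\to\kappa(\check P')\hookrightarrow\mathbb T$, where $\check P'$ is the maximal element of $\operatorname{Cont}_SS[M]$ containing $P'$ and $\kappa(\check P')\hookrightarrow\mathbb T$ is the embedding compatible with $S\subseteq\mathbb T$. For $P\in\operatorname{Cont}^\circ_SS[M]$ and $P'\in\operatorname{Cont}_SS[M]$, a *common Hahn embedding* is a totally ordered set $I$ with a least element $i_0$, together with injective semiring homomorphisms of $\kappa(P)$ and of $\kappa(P')$ into $\mathbb R^{(I)}\cup\{-\infty\}$ (with operations lexicographic maximum and addition; $\mathbb R^{(I)}$ is the group of functions $I\to\mathbb R$ with well-ordered support), both of which restrict on $S$ to the inclusion $S\subseteq\mathbb T$ followed by the inclusion of the factor with index $i_0$. **Theorem.** Let $P\in\operatorname{Cont}^\circ_SS[M]$. Pullback along $\iota$ is a well-defined and injective map $\iota^*:\operatorname{Cont}(S\langle M\rangle_P)\to\operatorname{Cont}_SS[M]$, and the map $\Phi:\operatorname{Cont}_SS[M]\to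 N_{\mathbb R}(\sigma)$ is well defined. For every $P'\in\operatorname{Cont}_SS[M]$ a common Hahn embedding of $\kappa(P)$ and $\kappa(P')$ exists, and for any choice of one, used to compare $|m|_P$ with $|m|_{P'}$, the following are equivalent: 1. $P'$ is in the image of $\iota^*$; 2. $c\,|m|_P\ge|m|_{P'}$ for all $c\in S$ with $c>1_S$ and all terms $m=a\chi^u\in S[M]$ ($a\in S$, $u\in M$); 3. $\Phi(P')\in\Phi(P)+_{\mathbb R}\bar\sigma$. -/

import Mathlib

universe u

namespace TropCont

/-! ### Idempotent semirings, totally ordered semifields, the tropical semifield -/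

/-- The canonical relation `x ≤ y` of an (additively idempotent) semiring: `x + y = y`. -/
def Leq {K : Type*} [CommSemiring K] (x y : K) : Prop := x + y = y

/-- The totally ordered semifield `G ∪ {-∞}` with operations `(max, +)` attached to a totally
ordered abelian group `G`. -/
def MaxPlus (G : Type*) : Type _ := WithBot G

namespace MaxPlus

set_option linter.unusedSectionVars false

variable {G : Type*} [AddCommGroup G] [LinearOrder G] [IsOrderedAddMonoid G]

/-- The element `t ^ g` of the semifield corresponding to `g : G`. -/
def t {G : Type*} (g : G) : MaxPlus G := (g : WithBot G)

noncomputable instance : LinearOrder (MaxPlus G) := inferInstanceAs (LinearOrder (WithBot G))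

noncomputable instance : Add (MaxPlus G) := ⟨fun x y => max x y⟩
instance : Zero (MaxPlus G) := ⟨(⊥ : WithBot G)⟩
noncomputable instance : Mul (MaxPlus G) := ⟨fun x y => @HAdd.hAdd (WithBot G) (WithBot G) (WithBot G) _ x y⟩
instance : One (MaxPlus G) := ⟨t 0⟩

noncomputable instance : CommSemiring (MaxPlus G) where
  add_assoc x y z := max_assoc x y z
  add_comm x y := max_comm x y
  zero_add x := bot_sup_eq (α := WithBot G) x
  add_zero x := sup_bot_eq (α := WithBot G) x
  nsmul := nsmulRec
  mul_assoc x y z := add_assoc (G := WithBot G) x y z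
  mul_comm x y := add_comm (G := WithBot G) x y
  one_mul x := zero_add (M := WithBot G) x
  mul_one x := add_zero (M := WithBot G) x
  zero_mul x := WithBot.bot_add (α := G) x
  mul_zero x := WithBot.add_bot (α := G) x
  left_distrib x y z := (max_add_add_left (α := WithBot G) x y z).symm
  right_distrib x y z := (max_add_add_right (α := WithBot G) x y z).symm

theorem add_eq_max (x y : MaxPlus G) : x + y = max x y := rfl

theorem leq_iff_le (x y : MaxPlus G) : Leq x y ↔ x ≤ y := max_eq_right_iff

theorem zero_ne_one : (0 : MaxPlus G) ≠ 1 := WithBot.bot_ne_coe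

end MaxPlus

/-- The tropical semifield `ℝ ∪ {-∞}`. -/
abbrev Trop : Type := MaxPlus ℝ

/-- `S` is a sub-semifield of the tropical semifield, different from the Boolean semifield. -/
structure IsSubsemifield (S : Subsemiring Trop) : Prop where
  inv : ∀ a ∈ S, a ≠ 0 → ∃ b ∈ S, a * b = 1
  ne_bool : ∃ a ∈ S, a ≠ 0 ∧ a ≠ 1

/-- The semifield `ℝ^(I) ∪ {-∞}`, where `ℝ^(I)` is the group of functions `I → ℝ` with
well-ordered support, ordered lexicographically. -/
abbrev LexSemifield (I : Type*) [LinearOrder I] : Type _ := MaxPlus (Lex (HahnSeries I ℝ))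

/-- The inclusion of the tropical semifield as the factor of the least index. -/
noncomputable def lexIncl (I : Type*) [LinearOrder I] [OrderBot I] (x : Trop) : LexSemifield I :=
  WithBot.map (fun r : ℝ => toLex (HahnSeries.single (⊥ : I) r)) x

/-- The canonical topology of a totally ordered semifield, with base the sets `{a}` and `[0, a]`
for `a` a unit. -/
@[reducible]
def canonicalTopology (K : Type*) [CommSemiring K] : TopologicalSpace K :=
  TopologicalSpace.generateFrom
    ({U | ∃ a : K, IsUnit a ∧ U = {a}} ∪ {U | ∃ a : K, IsUnit a ∧ U = {x | Leq x a}})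

/-! ### Prime congruences and continuous spectra -/

/-- A congruence `P` on `A` is prime if it is proper and `A / P` is totally ordered and
cancellative. -/
structure IsPrimeCong {A : Type*} [CommSemiring A] (P : RingCon A) : Prop where
  proper : (0 : P.Quotient) ≠ 1
  total : ∀ x y : P.Quotient, Leq x y ∨ Leq y x
  cancel : ∀ a b c : P.Quotient, a ≠ 0 → a * b = a * c → b = c

/-- The submonoid of cancellative elements. -/
def cancellative (R : Type*) [CommSemiring R] : Submonoid R where
  carrier := {a | ∀ b c, a * b = a * c → b = c}
  one_mem' b c h := by simpa using h
  mul_mem' {x y} hx hy b c h := hy b c (hx _ _ (by simpa [mul_assoc] using h))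

/-- The residue semifield `κ(P)`: the total semiring of fractions of `A / P`. -/
abbrev ResidueSemifield {A : Type*} [CommSemiring A] (P : RingCon A) : Type _ :=
  Localization (cancellative P.Quotient)

/-- The canonical homomorphism `A → κ(P)`, written `a ↦ |a|_P`. -/
noncomputable def absv {A : Type*} [CommSemiring A] (P : RingCon A) : A →+* ResidueSemifield P :=
  (algebraMap P.Quotient (ResidueSemifield P)).comp P.mk'

/-- The continuous spectrum of a semiring `A` with topology `τ`: the prime congruences `P` such
that `A / P` is not the Boolean semifield and `A → κ(P)` is continuous. -/
def ContSpec (A : Type*) [CommSemiring A] (τ : TopologicalSpace A) : Set (RingCon A) :=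
  {P | IsPrimeCong P ∧ (∃ x : P.Quotient, x ≠ 0 ∧ x ≠ 1) ∧
    @Continuous _ _ τ (canonicalTopology (ResidueSemifield P)) (absv P)}

/-- The universal semiring topology on `A` attached to a function `ψ : X → A` on a topological
space: the topology generated by all initial topologies with respect to homomorphisms `φ : A → B`
to topological semirings with `φ ∘ ψ` continuous. (`sInf` is the join of topologies in the sense of
inclusion of families of open sets.) -/
@[reducible]
def universalTopology {X : Type*} {A : Type u} [CommSemiring A] (tX : TopologicalSpace X)
    (ψ : X → A) : TopologicalSpace A :=
  sInf {τ | ∃ (B : Type u) (_ : CommSemiring B) (tB : TopologicalSpace B)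
    (_ : IsTopologicalSemiring B) (φ : A →+* B),
    @Continuous _ _ tX tB (fun x => φ (ψ x)) ∧ τ = TopologicalSpace.induced φ tB}

/-- `Cont_S A`: the continuous spectrum of the `S`-algebra `A` with the universal topology. -/
def ContBase (S : Type*) (A : Type*) [CommSemiring S] [CommSemiring A] [Algebra S A] :
    Set (RingCon A) :=
  ContSpec A (universalTopology (canonicalTopology S) (algebraMap S A))

/-- `Cont°_S A`: the elements of `Cont_S A` with trivial ideal-kernel. -/
def ContBaseInt (S : Type*) (A : Type*) [CommSemiring S] [CommSemiring A] [Algebra S A] :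
    Set (RingCon A) :=
  {P | P ∈ ContBase S A ∧ ∀ a : A, P a 0 → a = 0}

/-! ### Convergent power series -/

open Classical in
/-- The greatest element of a set, if there is one, and `0` otherwise. -/
noncomputable def greatest {K : Type*} [CommSemiring K] (s : Set K) : K :=
  if h : ∃ c, c ∈ s ∧ ∀ x ∈ s, Leq x c then h.choose else 0

section Series

variable {S : Subsemiring Trop} {M : Type u} [AddCommMonoid M]

/-- The series `∑ f_u χ^u` converges at `P`: for every nonzero `b ∈ S[M] / P` there are only
finitely many `u` with `|f_u χ^u|_P ≥ b`. -/
def ConvergesAt (P : RingCon (AddMonoidAlgebra S M)) (f : M → S) : Prop :=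
  ∀ b : P.Quotient, b ≠ 0 →
    {u : M | Leq b ((AddMonoidAlgebra.single u (f u) : AddMonoidAlgebra S M) : P.Quotient)}.Finite

/-- The product of two series: the coefficient at `u` is the greatest `f_v g_w` with
`v + w = u`. -/
noncomputable def seriesMul (f g : M → S) (u : M) : S :=
  greatest {c | ∃ v w : M, v + w = u ∧ c = f v * g w}

/-! Elementary facts about the order. -/

section Order

variable {K : Type*} [CommSemiring K]

theorem Leq.trans {a b c : K} (h : Leq a b) (h' : Leq b c) : Leq a c := by
  unfold Leq at *
  rw [← h', ← add_assoc, h]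

theorem Leq.antisymm {a b : K} (h : Leq a b) (h' : Leq b a) : a = b := by
  unfold Leq at *
  rw [← h', add_comm, h]

theorem Leq.mul_right {a b : K} (h : Leq a b) (c : K) : Leq (a * c) (b * c) := by
  unfold Leq at *
  rw [← add_mul, h]

theorem Leq.mul_left {a b : K} (h : Leq a b) (c : K) : Leq (c * a) (c * b) := by
  unfold Leq at *
  rw [← mul_add, h]

theorem leq_zero_left (a : K) : Leq 0 a := zero_add a

theorem Leq.map {K' : Type*} [CommSemiring K'] (φ : K →+* K') {a b : K} (h : Leq a b) :
    Leq (φ a) (φ b) := by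
  unfold Leq at *
  rw [← map_add, h]

theorem greatest_eq {s : Set K} {c : K} (hc : c ∈ s) (h : ∀ x ∈ s, Leq x c) : greatest s = c := by
  have hex : ∃ c, c ∈ s ∧ ∀ x ∈ s, Leq x c := ⟨c, hc, h⟩
  rw [greatest, dif_pos hex]
  exact (h _ hex.choose_spec.1).antisymm (hex.choose_spec.2 _ hc)

end Order

theorem coe_leq_iff (a b : S) : Leq a b ↔ (a : Trop) ≤ b := by
  rw [← MaxPlus.leq_iff_le, Leq, Leq, ← Subtype.coe_inj]
  rfl

theorem leq_refl (a : S) : Leq a a := (coe_leq_iff a a).2 le_rfl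

theorem leq_total (a b : S) : Leq a b ∨ Leq b a := by
  rw [coe_leq_iff, coe_leq_iff]
  exact le_total _ _

theorem leq_add_left (a b : S) : Leq a (a + b) := by
  rw [coe_leq_iff]
  exact le_max_left (a : Trop) b

theorem leq_add_right (a b : S) : Leq b (a + b) := by
  rw [coe_leq_iff]
  exact le_max_right (a : Trop) b

theorem add_leq {a b c : S} (h : Leq a c) (h' : Leq b c) : Leq (a + b) c := by
  rw [coe_leq_iff] at *
  exact max_le h h'

theorem add_eq_or (a b : S) : a + b = a ∨ a + b = b := by
  rcases leq_total a b with h | h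
  · exact Or.inr h
  · exact Or.inl (by rw [add_comm]; exact h)

theorem coe_ne_zero_of_isUnit {a : S} (h : IsUnit a) : a ≠ 0 := by
  rintro rfl
  obtain ⟨b, hb⟩ := h.exists_right_inv
  rw [zero_mul] at hb
  exact MaxPlus.zero_ne_one (congrArg Subtype.val hb)

/-- Open neighbourhoods of zero contain an interval. -/
theorem exists_interval {U : Set S} (hU : @IsOpen _ (canonicalTopology S) U) (h0 : (0 : S) ∈ U) :
    ∃ a : S, IsUnit a ∧ ∀ x, Leq x a → x ∈ U := by
  induction hU with
  | basic V hV =>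
    rcases hV with ⟨a, ha, rfl⟩ | ⟨a, ha, rfl⟩
    · exact absurd (Set.mem_singleton_iff.1 h0).symm (coe_ne_zero_of_isUnit ha)
    · exact ⟨a, ha, fun x hx => hx⟩
  | univ => exact ⟨1, isUnit_one, fun _ _ => trivial⟩
  | inter V W _ _ ihV ihW =>
    obtain ⟨a, ha, hV⟩ := ihV h0.1
    obtain ⟨b, hb, hW⟩ := ihW h0.2
    rcases leq_total a b with h | h
    · exact ⟨a, ha, fun x hx => ⟨hV x hx, hW x (hx.trans h)⟩⟩
    · exact ⟨b, hb, fun x hx => ⟨hV x (hx.trans h), hW x hx⟩⟩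
  | sUnion F _ ih =>
    obtain ⟨V, hV, h0V⟩ := h0
    obtain ⟨a, ha, h⟩ := ih V hV h0V
    exact ⟨a, ha, fun x hx => ⟨V, hV, h x hx⟩⟩

section General

variable {A : Type u} [CommSemiring A] {P : RingCon A}

theorem q_refl (hP : IsPrimeCong P) (x : P.Quotient) : Leq x x := by
  rcases hP.total x x with h | h <;> exact h

theorem q_leq_of_mul (hP : IsPrimeCong P) {x y z : P.Quotient} (hz : z ≠ 0)
    (h : Leq (x * z) (y * z)) : Leq x y := by
  rcases hP.total x y with h' | h'
  · exact h'
  · have := hP.cancel z x y hz (by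
      rw [mul_comm z x, mul_comm z y]
      exact h.antisymm (h'.mul_right z))
    rw [this]
    exact q_refl hP y

theorem q_not_leq_zero {b : P.Quotient} (hb : b ≠ 0) : ¬ Leq b 0 := fun h =>
  hb (h.antisymm (leq_zero_left b))

end General

/-- The structure map to the residue semifield of an element of `Cont_S` is continuous. -/
theorem continuous_base {A : Type u} [CommSemiring A] [Algebra S A] {P : RingCon A}
    (hP : P ∈ ContBase S A) :
    @Continuous _ _ (canonicalTopology S) (canonicalTopology (ResidueSemifield P))
      (fun s : S => absv P (algebraMap S A s)) := by
  refine @Continuous.comp _ _ _ (canonicalTopology S)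
    (universalTopology (canonicalTopology S) (algebraMap S A))
    (canonicalTopology (ResidueSemifield P)) _ _ hP.2.2 ?_
  unfold universalTopology
  refine continuous_sInf_rng.2 ?_
  rintro τ ⟨B, iB, tB, iT, φ, hφ, rfl⟩
  let _ := canonicalTopology S
  exact continuous_induced_rng.2 hφ

/-- Every nonzero fraction is bounded below by a nonzero element. -/
theorem exists_small {A : Type u} [CommSemiring A] [Algebra S A] {P : RingCon A}
    (hP : P ∈ ContBase S A) {x y : P.Quotient} (hx : x ≠ 0) (hy : y ≠ 0) : ∃ s : P.Quotient, s ≠ 0 ∧ Leq (s * y) x := by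
  have hpr := hP.1
  have hc : ∀ z : P.Quotient, z ≠ 0 → z ∈ cancellative P.Quotient := fun z hz b c h =>
    hpr.cancel z b c hz h
  let κ : Type u := ResidueSemifield P
  let a : κ := IsLocalization.mk' κ x ⟨y, hc y hy⟩
  have ha : IsUnit a := by
    refine IsUnit.of_mul_eq_one (IsLocalization.mk' κ y ⟨x, hc x hx⟩) ?_
    exact IsLocalization.mk'_mul_mk'_eq_one' x ⟨y, hc y hy⟩ (hc x hx)
  have hop : @IsOpen _ (canonicalTopology κ) {z : κ | Leq z a} :=
    TopologicalSpace.isOpen_generateFrom_of_mem (Or.inr ⟨a, ha, rfl⟩)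
  have hpre := (@Continuous.isOpen_preimage _ _ (canonicalTopology S) (canonicalTopology κ) _
    (continuous_base hP)) _ hop
  obtain ⟨s, hs, hsU⟩ := exists_interval hpre (by
    simp only [Set.mem_preimage, map_zero]
    exact leq_zero_left a)
  have hsa : Leq (absv P (algebraMap S _ s)) a := hsU s (leq_refl s)
  refine ⟨P.mk' (algebraMap S _ s), ?_, ?_⟩
  · intro h0
    obtain ⟨r, hr⟩ := hs.exists_right_inv
    apply hpr.proper
    have := congrArg (fun z => P.mk' (algebraMap S A z)) hr
    simp only [map_mul, map_one] at this
    rw [← this, h0, zero_mul]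
  · let y' : κ := algebraMap P.Quotient κ y
    have h1 : Leq (absv P (algebraMap S _ s) * y') (a * y') := Leq.mul_right hsa y'
    have h2 : a * y' = algebraMap P.Quotient κ x :=
      IsLocalization.mk'_spec κ x ⟨y, hc y hy⟩
    rw [h2] at h1
    have hinj : Function.Injective (algebraMap P.Quotient κ) := by
      intro p q hpq
      obtain ⟨c, hcq⟩ := IsLocalization.exists_of_eq (M := cancellative P.Quotient)
        (S := ResidueSemifield P) hpq
      exact c.2 _ _ hcq
    apply hinj
    rw [map_add, map_mul]
    exact h1

section Prime

variable {P : RingCon (AddMonoidAlgebra S M)}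

/-- The value of the term `a χ^u` in `S[M] / P`. -/
noncomputable def tv (P : RingCon (AddMonoidAlgebra S M)) (u : M) (a : S) : P.Quotient :=
  ((AddMonoidAlgebra.single u a : AddMonoidAlgebra S M) : P.Quotient)

theorem tv_zero (u : M) : tv P u 0 = 0 := by
  simp [tv]

theorem tv_mul (v w : M) (a b : S) : tv P (v + w) (a * b) = tv P v a * tv P w b := by
  rw [tv, tv, tv, ← RingCon.coe_mul, AddMonoidAlgebra.single_mul_single]

theorem tv_leq {a b : S} (u : M) (h : Leq a b) : Leq (tv P u a) (tv P u b) := by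
  unfold Leq at *
  rw [tv, tv, ← RingCon.coe_add, ← AddMonoidAlgebra.single_add, h]

/-- A convergent series is bounded. -/
theorem exists_bound (hP : IsPrimeCong P) {f : M → S} (hf : ConvergesAt P f) :
    ∃ m : P.Quotient, m ≠ 0 ∧ ∀ u, Leq (tv P u (f u)) m := by
  classical
  have hfin := hf 1 hP.proper.symm
  have key : ∀ F : Finset M, Leq 1 (1 + ∑ u ∈ F, tv P u (f u)) ∧
      ∀ u ∈ F, Leq (tv P u (f u)) (1 + ∑ u ∈ F, tv P u (f u)) := by
    intro F
    constructor
    · have := q_refl hP (1 : P.Quotient)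
      unfold Leq at *
      rw [← add_assoc, this]
    · intro u hu
      have := q_refl hP (tv P u (f u))
      rw [← Finset.add_sum_erase F _ hu]
      unfold Leq at *
      rw [add_left_comm 1, ← add_assoc, this]
  refine ⟨1 + ∑ u ∈ hfin.toFinset, tv P u (f u), ?_, ?_⟩
  · intro h
    have := (key hfin.toFinset).1
    rw [h] at this
    exact q_not_leq_zero hP.proper.symm this
  · intro u
    by_cases hu : u ∈ hfin.toFinset
    · exact (key _).2 u hu
    · refine Leq.trans ?_ (key _).1
      rcases hP.total (tv P u (f u)) 1 with h | h
      · exact h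
      · exact absurd (hfin.mem_toFinset.2 h) hu

theorem finite_of_mul (hP : P ∈ ContBase S (AddMonoidAlgebra S M)) {f : M → S}
    (hf : ConvergesAt P f) {b m : P.Quotient} (hb : b ≠ 0) (hm : m ≠ 0) :
    {v : M | Leq b (tv P v (f v) * m)}.Finite := by
  obtain ⟨s, hs, hsb⟩ := exists_small hP hb hm
  exact (hf s hs).subset fun v hv => q_leq_of_mul hP.1 hm (hsb.trans hv)

/-- The product of two convergent series exists. -/
theorem seriesMul_isGreatest (hP : P ∈ ContBaseInt S (AddMonoidAlgebra S M)) {f g : M → S}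
    (hf : ConvergesAt P f) (hg : ConvergesAt P g) (u : M) :
    (∃ v w, v + w = u ∧ seriesMul f g u = f v * g w) ∧
      ∀ v w, v + w = u → Leq (f v * g w) (seriesMul f g u) := by
  classical
  suffices h : ∃ v w, v + w = u ∧ ∀ v' w', v' + w' = u → Leq (f v' * g w') (f v * g w) by
    obtain ⟨v, w, hvw, hmax⟩ := h
    have : seriesMul f g u = f v * g w := greatest_eq ⟨v, w, hvw, rfl⟩ (by
      rintro _ ⟨v', w', h', rfl⟩
      exact hmax v' w' h')
    rw [this]
    exact ⟨⟨v, w, hvw, rfl⟩, hmax⟩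
  by_cases hz : ∀ v w, v + w = u → f v * g w = 0
  · refine ⟨u, 0, add_zero u, fun v' w' h' => ?_⟩
    rw [hz v' w' h']
    exact leq_zero_left _
  push Not at hz
  obtain ⟨v₀, w₀, h₀, hne⟩ := hz
  have hb : tv P u (f v₀ * g w₀) ≠ 0 := by
    intro h
    have h2 := hP.2 (AddMonoidAlgebra.single u (f v₀ * g w₀)) ((RingCon.eq P).1 h)
    exact hne (by simpa using h2)
  obtain ⟨mf, hmf, hmf'⟩ := exists_bound hP.1.1 hf
  obtain ⟨mg, hmg, hmg'⟩ := exists_bound hP.1.1 hg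
  have hF : {p : M × M | p.1 + p.2 = u ∧
      Leq (tv P u (f v₀ * g w₀)) (tv P u (f p.1 * g p.2))}.Finite := by
    refine ((finite_of_mul hP.1 hf hb hmg).prod (finite_of_mul hP.1 hg hb hmf)).subset ?_
    rintro ⟨v, w⟩ ⟨hvw, hle⟩
    simp only at hvw hle
    have hle' : Leq (tv P u (f v₀ * g w₀)) (tv P v (f v) * tv P w (g w)) := by
      rw [← tv_mul, hvw]
      exact hle
    refine ⟨hle'.trans ((hmg' w).mul_left _), ?_⟩
    rw [mul_comm (tv P v (f v))] at hle'
    exact hle'.trans ((hmf' v).mul_left _)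
  obtain ⟨p, hp, hpmax⟩ := hF.exists_maximalFor
    (fun p : M × M => ((f p.1 * g p.2 : S) : Trop)) _ ⟨(v₀, w₀), h₀, q_refl hP.1.1 _⟩
  have hp0 : Leq (f v₀ * g w₀) (f p.1 * g p.2) := by
    rcases leq_total (f v₀ * g w₀) (f p.1 * g p.2) with h | h
    · exact h
    · rw [coe_leq_iff] at *
      exact hpmax (j := (v₀, w₀)) ⟨h₀, q_refl hP.1.1 _⟩ h
  refine ⟨p.1, p.2, hp.1, fun v w hvw => ?_⟩
  rcases leq_total (f v * g w) (f p.1 * g p.2) with h | h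
  · exact h
  · have hmem : Leq (tv P u (f v₀ * g w₀)) (tv P u (f v * g w)) := tv_leq u (hp0.trans h)
    rw [coe_leq_iff] at *
    exact hpmax (j := (v, w)) ⟨hvw, hmem⟩ h

theorem convergesAt_mul (hP : P ∈ ContBaseInt S (AddMonoidAlgebra S M)) {f g : M → S}
    (hf : ConvergesAt P f) (hg : ConvergesAt P g) : ConvergesAt P (seriesMul f g) := by
  intro b hb
  obtain ⟨mf, hmf, hmf'⟩ := exists_bound hP.1.1 hf
  obtain ⟨mg, hmg, hmg'⟩ := exists_bound hP.1.1 hg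
  refine ((finite_of_mul hP.1 hf hb hmg).add (finite_of_mul hP.1 hg hb hmf)).subset ?_
  intro u hu
  change Leq b (tv P u _) at hu
  obtain ⟨⟨v, w, hvw, heq⟩, -⟩ := seriesMul_isGreatest hP hf hg u
  rw [heq, ← hvw, tv_mul] at hu
  refine ⟨v, hu.trans ((hmg' w).mul_left _), w, ?_, hvw⟩
  rw [mul_comm (tv P v (f v))] at hu
  exact hu.trans ((hmf' v).mul_left _)

theorem convergesAt_add {f g : M → S} (hf : ConvergesAt P f) (hg : ConvergesAt P g) :
    ConvergesAt P (f + g) := by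
  intro b hb
  refine ((hf b hb).union (hg b hb)).subset fun u hu => ?_
  simp only [Set.mem_ofPred_eq, Pi.add_apply] at hu
  rcases add_eq_or (f u) (g u) with h | h
  · rw [h] at hu
    exact Or.inl hu
  · rw [h] at hu
    exact Or.inr hu

theorem convergesAt_coeff (f : AddMonoidAlgebra S M) : ConvergesAt P (fun u => f.coeff u) := by
  intro b hb
  refine f.coeff.support.finite_toSet.subset fun u hu => ?_
  rw [Finset.mem_coe, Finsupp.mem_support_iff]
  intro h0
  change Leq b (tv P u (f.coeff u)) at hu
  rw [h0, tv_zero] at hu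
  exact q_not_leq_zero hb hu

end Prime

/-! The semiring of convergent series. -/

variable {P : RingCon (AddMonoidAlgebra S M)}

/-- The set of series that converge at `P`, for `P ∈ Cont°_S S[M]`. -/
def Cnvg (_hP : P ∈ ContBaseInt S (AddMonoidAlgebra S M)) : Type u :=
  {f : M → S // ConvergesAt P f}

variable {hP : P ∈ ContBaseInt S (AddMonoidAlgebra S M)}

namespace Cnvg

theorem ext {f g : Cnvg hP} (h : ∀ u, f.1 u = g.1 u) : f = g := Subtype.ext (funext h)

noncomputable instance : Zero (Cnvg hP) := ⟨⟨fun u => (0 : AddMonoidAlgebra S M).coeff u, convergesAt_coeff 0⟩⟩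
noncomputable instance : One (Cnvg hP) :=
  ⟨⟨fun u => (1 : AddMonoidAlgebra S M).coeff u, convergesAt_coeff 1⟩⟩
noncomputable instance : Add (Cnvg hP) := ⟨fun f g => ⟨f.1 + g.1, convergesAt_add f.2 g.2⟩⟩
noncomputable instance : Mul (Cnvg hP) :=
  ⟨fun f g => ⟨seriesMul f.1 g.1, convergesAt_mul hP f.2 g.2⟩⟩

theorem zero_apply (u : M) : (0 : Cnvg hP).1 u = 0 := rfl
theorem add_apply (f g : Cnvg hP) (u : M) : (f + g).1 u = f.1 u + g.1 u := rfl

theorem mul_spec (f g : Cnvg hP) (u : M) :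
    (∃ v w, v + w = u ∧ (f * g).1 u = f.1 v * g.1 w) ∧
      ∀ v w, v + w = u → Leq (f.1 v * g.1 w) ((f * g).1 u) :=
  seriesMul_isGreatest hP f.2 g.2 u

theorem mul_eq {f g : Cnvg hP} {u : M} {c : S} (h : ∃ v w, v + w = u ∧ c = f.1 v * g.1 w)
    (h' : ∀ v w, v + w = u → Leq (f.1 v * g.1 w) c) : (f * g).1 u = c := by
  refine greatest_eq h ?_
  rintro _ ⟨v, w, hvw, rfl⟩
  exact h' v w hvw

theorem mul_comm' (f g : Cnvg hP) : f * g = g * f := by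
  refine ext fun u => mul_eq ?_ ?_
  · obtain ⟨v, w, h, e⟩ := (mul_spec g f u).1
    exact ⟨w, v, by rw [add_comm, h], by rw [e, mul_comm]⟩
  · intro v w h
    rw [mul_comm]
    exact (mul_spec g f u).2 w v (by rw [add_comm, h])

theorem mul_assoc' (f g h : Cnvg hP) : f * g * h = f * (g * h) := by
  refine ext fun u => mul_eq ?_ ?_
  · obtain ⟨a, x, hax, e⟩ := (mul_spec f (g * h) u).1
    obtain ⟨b, c, hbc, e'⟩ := (mul_spec g h x).1
    refine ⟨a + b, c, by rw [add_assoc, hbc, hax], ?_⟩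
    refine Leq.antisymm ?_ ?_
    · rw [e, e', ← mul_assoc]
      exact ((mul_spec f g (a + b)).2 a b rfl).mul_right _
    · obtain ⟨a', b', hab, e''⟩ := (mul_spec f g (a + b)).1
      rw [e'', mul_assoc]
      refine (((mul_spec g h (b' + c)).2 b' c rfl).mul_left _).trans ?_
      exact (mul_spec f (g * h) u).2 a' (b' + c) (by rw [← add_assoc, hab, add_assoc, hbc, hax])
  · intro y c hyc
    obtain ⟨a, b, hab, e⟩ := (mul_spec f g y).1
    rw [e, mul_assoc]
    refine (((mul_spec g h (b + c)).2 b c rfl).mul_left _).trans ?_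
    exact (mul_spec f (g * h) u).2 a (b + c) (by rw [← add_assoc, hab, hyc])

theorem one_apply_zero : (1 : Cnvg hP).1 0 = 1 := by
  change (1 : AddMonoidAlgebra S M).coeff 0 = 1
  simp [AddMonoidAlgebra.one_def]

theorem one_apply_ne {u : M} (h : u ≠ 0) : (1 : Cnvg hP).1 u = 0 := by
  change (1 : AddMonoidAlgebra S M).coeff u = 0
  simp [AddMonoidAlgebra.one_def, h.symm]

theorem one_mul' (f : Cnvg hP) : 1 * f = f := by
  refine ext fun u => mul_eq ⟨0, u, zero_add u, by rw [one_apply_zero, one_mul]⟩ ?_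
  intro v w h
  by_cases hv : v = 0
  · subst hv
    rw [zero_add] at h
    rw [one_apply_zero, one_mul, h]
    exact leq_refl _
  · rw [one_apply_ne hv, zero_mul]
    exact leq_zero_left _

theorem zero_mul' (f : Cnvg hP) : 0 * f = 0 := by
  refine ext fun u => mul_eq ⟨0, u, zero_add u, ?_⟩ ?_
  · rw [zero_apply, zero_apply, zero_mul]
  · intro v w _
    rw [zero_apply, zero_mul]
    exact leq_zero_left _

theorem add_mul' (f g h : Cnvg hP) : (f + g) * h = f * h + g * h := by
  refine ext fun u => mul_eq ?_ ?_
  · rw [add_apply]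
    have key : ∀ f g : Cnvg hP, Leq ((f * h).1 u) ((g * h).1 u) →
        ∃ v w, v + w = u ∧ (f * h).1 u + (g * h).1 u = (f + g).1 v * h.1 w := by
      intro f g hle
      obtain ⟨v, w, hvw, e⟩ := (mul_spec g h u).1
      refine ⟨v, w, hvw, ?_⟩
      have hle' : (f * h).1 u + (g * h).1 u = (g * h).1 u := hle
      have hv : Leq (f.1 v * h.1 w) (g.1 v * h.1 w) := by
        rw [← e]
        exact ((mul_spec f h u).2 v w hvw).trans hle
      rw [hle', e, add_apply, add_mul]
      exact hv.symm
    rcases leq_total ((f * h).1 u) ((g * h).1 u) with hle | hle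
    · exact key f g hle
    · obtain ⟨v, w, hvw, e⟩ := key g f hle
      refine ⟨v, w, hvw, ?_⟩
      rw [add_comm, e, add_apply, add_apply, add_comm (g.1 v)]
  · intro v w hvw
    rw [add_apply, add_apply, add_mul]
    exact add_leq (((mul_spec f h u).2 v w hvw).trans (leq_add_left _ _))
      (((mul_spec g h u).2 v w hvw).trans (leq_add_right _ _))

noncomputable instance : CommSemiring (Cnvg hP) where
  add_assoc f g h := ext fun u => add_assoc _ _ _
  add_comm f g := ext fun u => add_comm _ _
  zero_add f := ext fun u => zero_add _
  add_zero f := ext fun u => add_zero _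
  nsmul := nsmulRec
  mul_assoc := mul_assoc'
  mul_comm := mul_comm'
  one_mul := one_mul'
  mul_one f := by rw [mul_comm', one_mul']
  zero_mul := zero_mul'
  mul_zero f := by rw [mul_comm', zero_mul']
  left_distrib f g h := by rw [mul_comm', add_mul', mul_comm' g, mul_comm' h]
  right_distrib := add_mul'

/-- The inclusion of polynomials, as an additive map. -/
noncomputable def inclAdd (hP : P ∈ ContBaseInt S (AddMonoidAlgebra S M)) :
    AddMonoidAlgebra S M →+ Cnvg hP where
  toFun f := ⟨fun u => f.coeff u, convergesAt_coeff f⟩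
  map_zero' := rfl
  map_add' _ _ := rfl

theorem inclAdd_single_mul (v w : M) (a b : S) :
    inclAdd hP (AddMonoidAlgebra.single v a * AddMonoidAlgebra.single w b) =
      inclAdd hP (AddMonoidAlgebra.single v a) * inclAdd hP (AddMonoidAlgebra.single w b) := by
  classical
  rw [AddMonoidAlgebra.single_mul_single]
  have hs : ∀ (x : M) (c : S) (y : M), (inclAdd hP (AddMonoidAlgebra.single x c)).1 y =
      if x = y then c else 0 := by
    intro x c y
    change (AddMonoidAlgebra.single x c).coeff y = _
    rw [AddMonoidAlgebra.coeff_single, Finsupp.single_apply]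
  refine ext fun u => (mul_eq ?_ ?_).symm
  · rw [hs]
    by_cases h : v + w = u
    · exact ⟨v, w, h, by rw [hs, hs, if_pos h, if_pos rfl, if_pos rfl]⟩
    · refine ⟨0, u, zero_add u, ?_⟩
      rw [hs, hs, if_neg h]
      by_cases hv : v = 0
      · rw [if_neg (c := w = u), mul_zero]
        rintro rfl
        exact h (by rw [hv, zero_add])
      · rw [if_neg hv, zero_mul]
  · intro v' w' h
    rw [hs, hs, hs]
    by_cases hv : v = v'
    · by_cases hw : w = w'
      · rw [if_pos hv, if_pos hw, if_pos (by rw [hv, hw, h])]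
        exact leq_refl _
      · rw [if_neg hw, mul_zero]
        exact leq_zero_left _
    · rw [if_neg hv, zero_mul]
      exact leq_zero_left _

/-- The inclusion `ι : S[M] → Cnvg(P)`. -/
noncomputable def incl (hP : P ∈ ContBaseInt S (AddMonoidAlgebra S M)) :
    AddMonoidAlgebra S M →+* Cnvg hP :=
  { inclAdd hP with
    map_one' := rfl
    map_mul' := by
      intro f g
      have : (AddMonoidHom.compHom (inclAdd hP)).comp AddMonoidHom.mul =
          (AddMonoidHom.mul.comp (inclAdd hP)).compl₂ (inclAdd hP) := by
        refine AddMonoidAlgebra.addMonoidHom_ext fun v a => ?_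
        refine AddMonoidAlgebra.addMonoidHom_ext fun w b => ?_
        exact inclAdd_single_mul v w a b
      exact DFunLike.congr_fun (DFunLike.congr_fun this f) g }

/-- The distance `d_P(f, g) ∈ κ(P)`: the maximum of `|(f_u + g_u) χ^u|_P` over all `u` with
`f_u ≠ g_u`, and `0` if there is no such `u`. -/
noncomputable def dist (f g : Cnvg hP) : ResidueSemifield P :=
  greatest {x | ∃ u : M, f.1 u ≠ g.1 u ∧ x = absv P (AddMonoidAlgebra.single u (f.1 u + g.1 u))}

/-- The topology on `Cnvg(P)` generated by the open balls
`{g | d_P(g, f) < r}` with `r ∈ κ(P)ˣ`. -/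
@[reducible]
noncomputable def topology (hP : P ∈ ContBaseInt S (AddMonoidAlgebra S M)) :
    TopologicalSpace (Cnvg hP) :=
  TopologicalSpace.generateFrom {U | ∃ (f : Cnvg hP) (r : ResidueSemifield P), IsUnit r ∧
    U = {g | Leq (dist g f) r ∧ dist g f ≠ r}}

end Cnvg

end Series

/-- A common Hahn embedding of `κ(P)` and `κ(P')` over `S`: embeddings into the same semifield
`ℝ^(I) ∪ {-∞}` whose restrictions to `S` are both the inclusion `S ⊆ 𝕋` followed by the inclusion
of the factor of the least index. -/
structure JointHahnEmbedding {S : Subsemiring Trop} {A : Type*} [CommSemiring A] [Algebra S A]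
    (P P' : RingCon A) (I : Type*) [LinearOrder I] [OrderBot I] where
  left : ResidueSemifield P →+* LexSemifield I
  right : ResidueSemifield P' →+* LexSemifield I
  left_injective : Function.Injective left
  right_injective : Function.Injective right
  left_base : ∀ s : S, left (absv P (algebraMap S A s)) = lexIncl I s
  right_base : ∀ s : S, right (absv P' (algebraMap S A s)) = lexIncl I s

/-! ### Toric monoids and tropical toric varieties -/

section Toric

variable {Λ : Type u} [AddCommGroup Λ]

/-- `σ ⊆ N_ℝ = Hom(Λ, ℝ)` is a strongly convex rational polyhedral cone. -/
structure IsToricCone (σ : PointedCone ℝ (Λ →+ ℝ)) : Prop where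
  rational : ∃ F : Finset (Λ →+ ℤ), σ = Submodule.span NNReal
    ((fun v : Λ →+ ℤ => (Int.castAddHom ℝ).comp v) '' (F : Set (Λ →+ ℤ)))
  strongly_convex : ∀ v ∈ σ, -v ∈ σ → v = 0

/-- The toric monoid `σ^∨ ∩ Λ`, where `σ^∨ = {u | ⟨v, u⟩ ≤ 0 for all v ∈ σ}`. -/
def toricMonoid (σ : PointedCone ℝ (Λ →+ ℝ)) : AddSubmonoid Λ where
  carrier := {u | ∀ v ∈ σ, v u ≤ 0}
  zero_mem' v _ := by simp
  add_mem' {a b} ha hb v hv := by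
    rw [map_add]
    exact add_nonpos (ha v hv) (hb v hv)

/-- The tropical toric variety `N_ℝ(σ) = Hom(σ^∨ ∩ Λ, 𝕋)`, a monoid under the pointwise product
of `𝕋` (which is denoted additively in `N_ℝ`). -/
abbrev TropicalToric (σ : PointedCone ℝ (Λ →+ ℝ)) : Type u :=
  Multiplicative (toricMonoid σ) →* Trop

/-- The identification of `𝕋` with the nonnegative reals, `t ^ r ↦ exp r` and `-∞ ↦ 0`. -/
noncomputable def tropExp (x : Trop) : ℝ :=
  WithBot.recBotCoe (C := fun _ => ℝ) 0 Real.exp x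

/-- The topology of `N_ℝ(σ)`: the subspace topology from the product of copies of
`𝕋 ≅ [0, ∞)`. -/
@[reducible]
noncomputable def toricTopology (σ : PointedCone ℝ (Λ →+ ℝ)) :
    TopologicalSpace (TropicalToric σ) :=
  TopologicalSpace.induced
    (fun w (u : toricMonoid σ) => tropExp (w (Multiplicative.ofAdd u))) inferInstance

/-- The embedding `N_ℝ → N_ℝ(σ)`, `v ↦ (u ↦ t ^ ⟨v, u⟩)`. -/
noncomputable def toToric (σ : PointedCone ℝ (Λ →+ ℝ)) (v : Λ →+ ℝ) : TropicalToric σ where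
  toFun u := MaxPlus.t (v (u.toAdd : Λ))
  map_one' := by
    rw [toAdd_one, ZeroMemClass.coe_zero, map_zero]
    rfl
  map_mul' x y := by
    rw [toAdd_mul, AddSubmonoid.coe_add, map_add]
    rfl

/-- The closure of `σ` in `N_ℝ(σ)`. -/
noncomputable def coneClosure (σ : PointedCone ℝ (Λ →+ ℝ)) : Set (TropicalToric σ) :=
  @closure _ (toricTopology σ) (toToric σ '' (σ : Set (Λ →+ ℝ)))

/-- `w : M → 𝕋` is the composition `M → S[M] → κ(Pmax) → 𝕋`, where `Pmax` is a maximal element of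
`Cont_S S[M]` containing `P` and `κ(Pmax) → 𝕋` is an embedding over `S`. -/
def IsTropicalPoint {S : Subsemiring Trop} {σ : PointedCone ℝ (Λ →+ ℝ)}
    (P : RingCon (AddMonoidAlgebra S (toricMonoid σ))) (w : TropicalToric σ) : Prop :=
  ∃ Pmax : RingCon (AddMonoidAlgebra S (toricMonoid σ)),
    Maximal (· ∈ ContBase S (AddMonoidAlgebra S (toricMonoid σ))) Pmax ∧ P ≤ Pmax ∧
    ∃ e : ResidueSemifield Pmax →+* Trop, Function.Injective e ∧
      (∀ s : S, e (absv Pmax (algebraMap S _ s)) = s) ∧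
      ∀ u : toricMonoid σ, w (Multiplicative.ofAdd u) = e (absv Pmax (AddMonoidAlgebra.single u 1))

/-- The map `Φ : Cont_S S[M] → N_ℝ(σ)`, sending `P` to the unique `w` as in `IsTropicalPoint`
(existence and uniqueness of `w` are asserted together with the theorem). -/
noncomputable def Phi {S : Subsemiring Trop} {σ : PointedCone ℝ (Λ →+ ℝ)}
    (P : RingCon (AddMonoidAlgebra S (toricMonoid σ))) : TropicalToric σ :=
  Classical.epsilon (IsTropicalPoint P)

end Toric

end TropCont

open TropCont

/-!
Everything is reduced to one object. A *tropicalization* of a congruence `P ∈ Cont_S A` is a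
homomorphism `φ : A → 𝕋` over `S` that factors through `A / P`. It is unique
(`IsTropicalization.unique`): if two of them differed at `a`, some element of `S` would lie strictly
between their values at a power of `a`, and could not be compared with that power in the totally
ordered semiring `A / P`. It exists because `κ(P)` has a Hahn embedding which on `S` is the
inclusion of the factor of the least index (`exists_hahn`); reading off the coefficient of that index
is a homomorphism to `𝕋`. The kernel of `φ` is the maximal element of `Cont_S A` above `P`, so `Φ(P)`
is the restriction of `φ` to the monomials (`isTropicalPoint_iff`). Common Hahn embeddings for `P`
and `P'` are obtained from embeddings of `κ(P)` and `κ(P')` by placing both index sets in their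
lexicographic product.

Membership in `Cont_S A` becomes an order condition (`mem_contBase_iff`): `P` is prime, `A / P` is
not Boolean, and the units of `S` become arbitrarily small in `κ(P)`.

A continuous prime `Q` on `S⟨M⟩_P` makes series with small terms small. Therefore the value of a
series at `Q` is attained by one of its terms (`Cnvg.exists_absv_leq_term`), and `Q` is determined by
the comparison of terms, that is, by its restriction to `S[M]`.

Each of the three conditions is equivalent to `Φ(P') ≤ Φ(P)` pointwise on `M`.

* For the Hahn condition (`JointHahnEmbedding.forall_le_iff`), a strict inequality between leading
  coefficients can be multiplied by taking powers of a monomial until it exceeds any given `c ∈ S`.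
* If `Φ(P') ≤ Φ(P)`, then terms converging to zero at `P` also do so at `P'`, and the greatest value
  of a term at `P'` extends `|·|_{P'}` continuously to `S⟨M⟩_P` (`Cnvg.mem_image_of_single_le`).
  Otherwise, scaled powers of a monomial converge to zero at `P` without doing so at `P'`
  (`Cnvg.single_le_of_mem_image`).
* `Φ(P)` has finite values, so the toric condition says that `Φ(P') - Φ(P)` lies in the closure of
  `σ`, and this closure consists of all points of `N_ℝ(σ)` that are at most `0_ℝ`, the unit of
  `(𝕋, ·)`, on `M` (`mem_coneClosure_iff`). The proof of the latter uses Fourier–Motzkin elimination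
  and, for each face of `M`, an element of `σ` that vanishes exactly on this face.
-/

namespace TropCont

/-! ### Totally ordered semifields and residue semifields -/

/-- A totally ordered (hence idempotent) semifield, as a property of a commutative semiring. -/
structure IsTotalSemifield (K : Type*) [CommSemiring K] : Prop where
  zero_ne_one : (0 : K) ≠ 1
  isUnit : ∀ x : K, x ≠ 0 → IsUnit x
  total : ∀ x y : K, Leq x y ∨ Leq y x

theorem Leq.add {K : Type*} [CommSemiring K] {a b c : K} (h : Leq a c) (h' : Leq b c) :
    Leq (a + b) c := by
  unfold Leq at *
  rw [add_assoc, h', h]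

theorem Leq.mul {K : Type*} [CommSemiring K] {a b c d : K} (h : Leq a b) (h' : Leq c d) :
    Leq (a * c) (b * d) :=
  (h.mul_right c).trans (h'.mul_left b)

theorem leq_map_iff {K L : Type*} [CommSemiring K] [CommSemiring L] {φ : K →+* L}
    (hφ : Function.Injective φ) {a b : K} : Leq (φ a) (φ b) ↔ Leq a b := by
  unfold Leq
  rw [← map_add, hφ.eq_iff]

namespace IsTotalSemifield

variable {K : Type*} [CommSemiring K]

theorem leq_refl (hK : IsTotalSemifield K) (x : K) : Leq x x := by
  rcases hK.total x x with h | h <;> exact h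

theorem ne_zero (hK : IsTotalSemifield K) {x : K} (hx : IsUnit x) : x ≠ 0 := by
  rintro rfl
  obtain ⟨y, hy⟩ := hx.exists_right_inv
  rw [zero_mul] at hy
  exact hK.zero_ne_one hy

theorem mul_ne_zero (hK : IsTotalSemifield K) {x y : K} (hx : x ≠ 0) (hy : y ≠ 0) : x * y ≠ 0 :=
  hK.ne_zero ((hK.isUnit x hx).mul (hK.isUnit y hy))

theorem leq_of_mul_right (hK : IsTotalSemifield K) {x y z : K} (hz : z ≠ 0)
    (h : Leq (x * z) (y * z)) : Leq x y := by
  obtain ⟨w, hw⟩ := (hK.isUnit z hz).exists_right_inv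
  have := h.mul_right w
  rwa [mul_assoc, mul_assoc, hw, mul_one, mul_one] at this

theorem not_leq_zero {a : K} (ha : a ≠ 0) : ¬ Leq a 0 := fun h =>
  ha (h.antisymm (leq_zero_left a))

theorem leq_add_left (hK : IsTotalSemifield K) (a b : K) : Leq a (a + b) := by
  have := hK.leq_refl a
  unfold Leq at *
  rw [← add_assoc, this]

theorem leq_add_right (hK : IsTotalSemifield K) (a b : K) : Leq b (a + b) := by
  rw [add_comm]
  exact hK.leq_add_left b a

theorem map_ne_zero (hK : IsTotalSemifield K) {L : Type*} [CommSemiring L]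
    (hL : IsTotalSemifield L) (φ : K →+* L) {x : K} (hx : x ≠ 0) : φ x ≠ 0 :=
  hL.ne_zero ((hK.isUnit x hx).map φ)

/-- If `1` is the least nonzero element, then there is no other nonzero element. -/
theorem eq_one_of_forall_one_leq (hK : IsTotalSemifield K) (h : ∀ a : K, a ≠ 0 → Leq 1 a) {a : K}
    (ha : a ≠ 0) : a = 1 := by
  obtain ⟨b, hb⟩ := (hK.isUnit a ha).exists_right_inv
  have hb0 : b ≠ 0 := by
    rintro rfl
    rw [mul_zero] at hb
    exact hK.zero_ne_one hb
  have := (h b hb0).mul_left a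
  rw [mul_one, hb] at this
  exact this.antisymm (h a ha)

theorem continuous_iff {X : Type*} (τ : TopologicalSpace X) {f : X → K} :
    @Continuous _ _ τ (canonicalTopology K) f ↔
      ∀ a : K, IsUnit a → IsOpen (f ⁻¹' {a}) ∧ IsOpen (f ⁻¹' {x | Leq x a}) := by
  rw [continuous_generateFrom_iff]
  constructor
  · intro h a ha
    exact ⟨h _ (Or.inl ⟨a, ha, rfl⟩), h _ (Or.inr ⟨a, ha, rfl⟩)⟩
  · rintro h s (⟨a, ha, rfl⟩ | ⟨a, ha, rfl⟩)
    exacts [(h a ha).1, (h a ha).2]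

theorem isOpen_singleton {a : K} (ha : IsUnit a) : @IsOpen _ (canonicalTopology K) {a} :=
  TopologicalSpace.isOpen_generateFrom_of_mem (Or.inl ⟨a, ha, rfl⟩)

theorem isOpen_leq {a : K} (ha : IsUnit a) : @IsOpen _ (canonicalTopology K) {x | Leq x a} :=
  TopologicalSpace.isOpen_generateFrom_of_mem (Or.inr ⟨a, ha, rfl⟩)

theorem isTopologicalSemiring (hK : IsTotalSemifield K) :
    @IsTopologicalSemiring K (canonicalTopology K) _ := by
  let τ := canonicalTopology K
  have hadd : ContinuousAdd K := by
    refine ⟨(continuous_iff _).2 fun a ha => ⟨?_, ?_⟩⟩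
    · have : (fun p : K × K => p.1 + p.2) ⁻¹' {a} =
          ({a} ×ˢ {x | Leq x a}) ∪ ({x | Leq x a} ×ˢ {a}) := by
        ext ⟨x, y⟩
        simp only [Set.mem_preimage, Set.mem_singleton_iff, Set.mem_union, Set.mem_prod,
          Set.mem_ofPred_eq]
        constructor
        · intro h
          have h1 := hK.leq_add_left x y
          have h2 := hK.leq_add_right x y
          rw [h] at h1 h2
          rcases hK.total x y with h' | h'
          · exact Or.inr ⟨h1, by rw [← h]; exact h'.symm⟩
          · exact Or.inl ⟨by rw [← h, add_comm]; exact h'.symm, h2⟩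
        · rintro (⟨rfl, h⟩ | ⟨h, rfl⟩)
          · rw [add_comm]
            exact h
          · exact h
      rw [this]
      exact ((isOpen_singleton ha).prod (isOpen_leq ha)).union
        ((isOpen_leq ha).prod (isOpen_singleton ha))
    · have : (fun p : K × K => p.1 + p.2) ⁻¹' {x | Leq x a} =
          {x | Leq x a} ×ˢ {x | Leq x a} := by
        ext ⟨x, y⟩
        simp only [Set.mem_preimage, Set.mem_prod, Set.mem_ofPred_eq]
        exact ⟨fun h => ⟨(hK.leq_add_left x y).trans h, (hK.leq_add_right x y).trans h⟩,
          fun h => h.1.add h.2⟩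
      rw [this]
      exact (isOpen_leq ha).prod (isOpen_leq ha)
  have hmul : ContinuousMul K := by
    refine ⟨(continuous_iff _).2 fun a ha => ⟨?_, ?_⟩⟩
    · have : (fun p : K × K => p.1 * p.2) ⁻¹' {a} =
          ⋃ b : {p : K × K // IsUnit p.1 ∧ IsUnit p.2 ∧ p.1 * p.2 = a},
            ({b.1.1} ×ˢ {b.1.2} : Set (K × K)) := by
        ext ⟨x, y⟩
        simp only [Set.mem_preimage, Set.mem_singleton_iff, Set.mem_iUnion, Set.mem_prod]
        constructor
        · intro h
          rw [← h] at ha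
          exact ⟨⟨(x, y), isUnit_of_mul_isUnit_left ha, isUnit_of_mul_isUnit_right ha, h⟩,
            rfl, rfl⟩
        · rintro ⟨⟨⟨b, c⟩, -, -, h⟩, rfl, rfl⟩
          exact h
      rw [this]
      exact isOpen_iUnion fun b => (isOpen_singleton b.2.1).prod (isOpen_singleton b.2.2.1)
    · have : (fun p : K × K => p.1 * p.2) ⁻¹' {x | Leq x a} =
          ⋃ b : {p : K × K // IsUnit p.1 ∧ IsUnit p.2 ∧ p.1 * p.2 = a},
            ({x | Leq x b.1.1} ×ˢ {x | Leq x b.1.2} : Set (K × K)) := by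
        ext ⟨x, y⟩
        simp only [Set.mem_preimage, Set.mem_iUnion, Set.mem_prod, Set.mem_ofPred_eq]
        constructor
        · intro h
          -- A nonzero factor `z` is paired with the bound `a / z` on the other one.
          have key : ∀ z w : K, z ≠ 0 → Leq (z * w) a →
              ∃ c, IsUnit z ∧ IsUnit c ∧ z * c = a ∧ Leq w c := by
            intro z w hz hle
            obtain ⟨i, hi⟩ := (hK.isUnit z hz).exists_right_inv
            refine ⟨i * a, hK.isUnit z hz, (IsUnit.of_mul_eq_one z (by rw [mul_comm, hi])).mul ha,
              by rw [← mul_assoc, hi, one_mul], ?_⟩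
            have := hle.mul_left i
            rwa [← mul_assoc, mul_comm i z, hi, one_mul] at this
          by_cases hx : x = 0
          · by_cases hy : y = 0
            · exact ⟨⟨(a, 1), ha, isUnit_one, mul_one a⟩, by rw [hx]; exact leq_zero_left _,
                by rw [hy]; exact leq_zero_left _⟩
            · obtain ⟨c, h1, h2, h3, h4⟩ := key y x hy (by rwa [mul_comm])
              exact ⟨⟨(c, y), h2, h1, by rwa [mul_comm]⟩, h4, hK.leq_refl y⟩
          · obtain ⟨c, h1, h2, h3, h4⟩ := key x y hx h
            exact ⟨⟨(x, c), h1, h2, h3⟩, hK.leq_refl x, h4⟩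
        · rintro ⟨⟨⟨b, c⟩, _, _, h⟩, h1, h2⟩
          have := Leq.mul h1 h2
          rwa [h] at this
      rw [this]
      exact isOpen_iUnion fun b => (isOpen_leq b.2.1).prod (isOpen_leq b.2.2.1)
  exact { hadd, hmul with }

end IsTotalSemifield

section Residue

variable {A : Type*} [CommSemiring A] {P : RingCon A}

theorem algebraMap_residue_injective (P : RingCon A) :
    Function.Injective (algebraMap P.Quotient (ResidueSemifield P)) := by
  intro p q hpq
  obtain ⟨c, hc⟩ := IsLocalization.exists_of_eq (M := cancellative P.Quotient)
    (S := ResidueSemifield P) hpq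
  exact c.2 _ _ hc

theorem absv_eq_iff {a b : A} : absv P a = absv P b ↔ P a b := by
  rw [absv, RingHom.comp_apply, RingHom.comp_apply, (algebraMap_residue_injective P).eq_iff]
  exact RingCon.eq P

theorem absv_leq_iff {a b : A} : Leq (absv P a) (absv P b) ↔ P (a + b) b := by
  unfold Leq
  rw [← map_add, absv_eq_iff]

theorem leq_quotient_iff {a b : A} :
    Leq (a : P.Quotient) (b : P.Quotient) ↔ Leq (absv P a) (absv P b) :=
  (leq_map_iff (algebraMap_residue_injective P)).symm

theorem quotient_eq_zero_iff {a : A} : (a : P.Quotient) = 0 ↔ absv P a = 0 := by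
  rw [← map_zero (absv P), absv_eq_iff, ← RingCon.eq]
  rfl

theorem IsPrimeCong.mem_cancellative (hP : IsPrimeCong P) {x : P.Quotient} :
    x ∈ cancellative P.Quotient ↔ x ≠ 0 := by
  refine ⟨?_, fun hx b c h => hP.cancel x b c hx h⟩
  rintro h rfl
  exact hP.proper (h 0 1 (by rw [zero_mul, zero_mul]))

theorem IsPrimeCong.exists_frac (hP : IsPrimeCong P) (x : ResidueSemifield P) :
    ∃ a b : A, absv P b ≠ 0 ∧ x * absv P b = absv P a := by
  obtain ⟨⟨p, q⟩, h⟩ := IsLocalization.surj (cancellative P.Quotient) x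
  obtain ⟨a, rfl⟩ := P.mk'_surjective p
  obtain ⟨q, hq⟩ := q
  obtain ⟨b, rfl⟩ := P.mk'_surjective q
  exact ⟨a, b, fun h0 => hP.mem_cancellative.1 hq (quotient_eq_zero_iff.2 h0), h⟩

theorem IsPrimeCong.isUnit_absv (hP : IsPrimeCong P) {a : A} (h : absv P a ≠ 0) :
    IsUnit (absv P a) :=
  IsLocalization.map_units (ResidueSemifield P)
    (⟨(a : P.Quotient), hP.mem_cancellative.2 fun h0 => h (quotient_eq_zero_iff.1 h0)⟩ :
      cancellative P.Quotient)

/-- The residue semifield of a prime congruence is a totally ordered semifield. -/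
theorem IsPrimeCong.isTotalSemifield (hP : IsPrimeCong P) :
    IsTotalSemifield (ResidueSemifield P) where
  zero_ne_one h := hP.proper (algebraMap_residue_injective P (by rw [map_zero, map_one, h]))
  isUnit x hx := by
    obtain ⟨a, b, hb, h⟩ := hP.exists_frac x
    have ha : absv P a ≠ 0 := by
      rw [← h]
      intro h0
      obtain ⟨c, hc⟩ := (hP.isUnit_absv hb).exists_right_inv
      apply hx
      rw [← mul_one x, ← hc, ← mul_assoc, h0, zero_mul]
    have := hP.isUnit_absv ha
    rw [← h] at this
    exact isUnit_of_mul_isUnit_left this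
  total x y := by
    obtain ⟨a, b, hb, h⟩ := hP.exists_frac x
    obtain ⟨c, d, hd, h'⟩ := hP.exists_frac y
    obtain ⟨e, he⟩ := ((hP.isUnit_absv hb).mul (hP.isUnit_absv hd)).exists_right_inv
    have hx : x = absv P (a * d) * e := by
      rw [map_mul, ← h, mul_assoc x, mul_assoc, he, mul_one]
    have hy : y = absv P (c * b) * e := by
      rw [map_mul, ← h', mul_assoc y, mul_comm (absv P d), mul_assoc, he, mul_one]
    rw [hx, hy]
    rcases hP.total ((a * d : A) : P.Quotient) ((c * b : A) : P.Quotient) with h | h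
    · exact Or.inl ((leq_quotient_iff.1 h).mul_right e)
    · exact Or.inr ((leq_quotient_iff.1 h).mul_right e)

variable {K : Type*} [CommSemiring K] {N : A →+* K}

/-- The kernel of a homomorphism to a totally ordered semifield is prime. -/
theorem IsTotalSemifield.isPrimeCong (hK : IsTotalSemifield K) (h : ∀ a b, P a b ↔ N a = N b) :
    IsPrimeCong P := by
  have hle : ∀ a b : A, Leq (N a) (N b) → Leq (a : P.Quotient) (b : P.Quotient) := by
    intro a b hab
    unfold Leq at *
    rw [← RingCon.coe_add, RingCon.eq, h, map_add, hab]
  constructor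
  · intro h0
    have h1 : P 0 1 := (RingCon.eq P).1 h0
    rw [h, map_zero, map_one] at h1
    exact hK.zero_ne_one h1
  · intro x y
    obtain ⟨a, rfl⟩ := P.mk'_surjective x
    obtain ⟨b, rfl⟩ := P.mk'_surjective y
    exact (hK.total (N a) (N b)).imp (hle a b) (hle b a)
  · intro x y z hx hyz
    obtain ⟨a, rfl⟩ := P.mk'_surjective x
    obtain ⟨b, rfl⟩ := P.mk'_surjective y
    obtain ⟨c, rfl⟩ := P.mk'_surjective z
    have ha : N a ≠ 0 := by
      intro h0
      apply hx
      rw [← map_zero N, ← h] at h0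
      exact (RingCon.eq P).2 h0
    rw [← map_mul, ← map_mul] at hyz
    have := (h _ _).1 ((RingCon.eq P).1 hyz)
    rw [map_mul, map_mul] at this
    exact (RingCon.eq P).2 ((h b c).2 ((hK.isUnit _ ha).mul_right_injective this))

/-- A homomorphism to a totally ordered semifield with kernel `P` extends to an embedding of the
residue semifield of `P`. -/
theorem IsTotalSemifield.exists_residue_lift (hK : IsTotalSemifield K)
    (h : ∀ a b, P a b ↔ N a = N b) :
    ∃ j : ResidueSemifield P →+* K, Function.Injective j ∧ ∀ a, j (absv P a) = N a := by
  have hP := hK.isPrimeCong h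
  have hker : P ≤ RingCon.ker N := fun {a b} hab => (RingCon.ker_apply N).2 ((h a b).1 hab)
  have hN : ∀ a, absv P a ≠ 0 → N a ≠ 0 := by
    intro a ha h0
    rw [← map_zero N, ← h, ← absv_eq_iff, map_zero] at h0
    exact ha h0
  have hg : ∀ y : cancellative P.Quotient, IsUnit (P.lift N hker y) := by
    rintro ⟨y, hy⟩
    obtain ⟨a, rfl⟩ := P.mk'_surjective y
    exact hK.isUnit _ (hN a fun h0 => hP.mem_cancellative.1 hy (quotient_eq_zero_iff.2 h0))
  refine ⟨IsLocalization.lift hg, ?_, fun a => IsLocalization.lift_eq hg _⟩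
  have hj : ∀ a, IsLocalization.lift (S := ResidueSemifield P) hg (absv P a) = N a :=
    fun a => IsLocalization.lift_eq hg _
  intro x y hxy
  obtain ⟨a, b, hb, hx⟩ := hP.exists_frac x
  obtain ⟨c, d, hd, hy⟩ := hP.exists_frac y
  have h1 := congrArg (IsLocalization.lift (S := ResidueSemifield P) hg) hx
  have h2 := congrArg (IsLocalization.lift (S := ResidueSemifield P) hg) hy
  rw [map_mul, hj, hj] at h1 h2
  have h3 : N (a * d) = N (c * b) := by
    rw [map_mul, map_mul, ← h1, ← h2, hxy]
    ring
  rw [← h, ← absv_eq_iff, map_mul, map_mul, ← hx, ← hy] at h3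
  refine ((hP.isUnit_absv hb).mul (hP.isUnit_absv hd)).mul_left_injective ?_
  change x * (absv P b * absv P d) = y * (absv P b * absv P d)
  rw [← mul_assoc, h3]
  ring

end Residue

/-! ### The tropical semifield and its sub-semifields -/

namespace MaxPlus

section

variable {G : Type*} [AddCommGroup G]

theorem t_add (a b : G) : t (a + b) = t a * t b := rfl

theorem t_zero : t (0 : G) = 1 := rfl

end

theorem t_pow {G : Type*} [AddCommGroup G] [LinearOrder G] [IsOrderedAddMonoid G] (a : G) (n : ℕ) :
    (t a) ^ n = t (n • a) := by
  induction n with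
  | zero => rw [pow_zero, zero_smul, t_zero]
  | succ n ih => rw [pow_succ, ih, succ_nsmul, t_add]

section

variable {G : Type*} [LinearOrder G]

theorem t_le_t {a b : G} : t a ≤ t b ↔ a ≤ b := WithBot.coe_le_coe

theorem t_lt_t {a b : G} : t a < t b ↔ a < b := WithBot.coe_lt_coe

theorem zero_le' (x : MaxPlus G) : 0 ≤ x := bot_le (α := WithBot G)

theorem zero_lt_t (a : G) : 0 < t a := WithBot.bot_lt_coe a

end

section

variable {G : Type*}

theorem t_injective : Function.Injective (t : G → MaxPlus G) := WithBot.coe_injective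

theorem t_ne_zero (a : G) : t a ≠ 0 := WithBot.coe_ne_bot

theorem exists_t {x : MaxPlus G} (hx : x ≠ 0) : ∃ g, x = t g := by
  obtain ⟨g, hg⟩ := WithBot.ne_bot_iff_exists.1 hx
  exact ⟨g, hg.symm⟩

end

theorem isTotalSemifield (G : Type*) [AddCommGroup G] [LinearOrder G] [IsOrderedAddMonoid G] :
    IsTotalSemifield (MaxPlus G) where
  zero_ne_one := zero_ne_one
  isUnit x hx := by
    obtain ⟨g, rfl⟩ := exists_t hx
    exact IsUnit.of_mul_eq_one (t (-g)) (by rw [← t_add, add_neg_cancel, t_zero])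
  total x y := by
    rw [leq_iff_le, leq_iff_le]
    exact le_total x y

end MaxPlus

theorem le_of_leq_map {A : Type*} [CommSemiring A] {G : Type*} [AddCommGroup G] [LinearOrder G]
    [IsOrderedAddMonoid G] (φ : A →+* MaxPlus G) {a b : A} (h : Leq a b) : φ a ≤ φ b :=
  (MaxPlus.leq_iff_le _ _).1 (h.map φ)

section Subsemifield

variable {S : Subsemiring Trop}

theorem IsSubsemifield.isTotalSemifield (hS : IsSubsemifield S) : IsTotalSemifield S where
  zero_ne_one h := MaxPlus.zero_ne_one (congrArg Subtype.val h)
  isUnit x hx := by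
    obtain ⟨b, hb, h⟩ := hS.inv x x.2 fun h => hx (Subtype.ext h)
    exact IsUnit.of_mul_eq_one ⟨b, hb⟩ (Subtype.ext h)
  total := leq_total

theorem exists_coe_eq_t {s : S} (hs : s ≠ 0) : ∃ r : ℝ, (s : Trop) = MaxPlus.t r :=
  MaxPlus.exists_t fun h => hs (Subtype.ext h)

theorem ne_zero_of_coe_eq_t {s : S} {r : ℝ} (h : (s : Trop) = MaxPlus.t r) : s ≠ 0 := by
  rintro rfl
  exact MaxPlus.t_ne_zero r h.symm

theorem IsSubsemifield.exists_inv (hS : IsSubsemifield S) {s : S} {r : ℝ}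
    (h : (s : Trop) = MaxPlus.t r) : ∃ s' : S, s * s' = 1 ∧ (s' : Trop) = MaxPlus.t (-r) := by
  obtain ⟨s', hs'⟩ := (hS.isTotalSemifield.isUnit s (ne_zero_of_coe_eq_t h)).exists_right_inv
  refine ⟨s', hs', ?_⟩
  obtain ⟨r', hr'⟩ := exists_coe_eq_t (s := s') (by
    rintro rfl
    rw [mul_zero] at hs'
    exact hS.isTotalSemifield.zero_ne_one hs')
  have h1 := congrArg Subtype.val hs'
  have h2 : MaxPlus.t (r + r') = MaxPlus.t 0 := by
    rw [MaxPlus.t_add, ← h, ← hr', MaxPlus.t_zero]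
    exact h1
  have h3 := MaxPlus.t_injective h2
  rw [hr', eq_neg_of_add_eq_zero_right h3]

/-- `S` has an element `t ^ r` with `r > 0`. -/
theorem IsSubsemifield.exists_pos (hS : IsSubsemifield S) :
    ∃ (s : S) (r : ℝ), 0 < r ∧ (s : Trop) = MaxPlus.t r := by
  obtain ⟨a, ha, h0, h1⟩ := hS.ne_bool
  obtain ⟨r, rfl⟩ := MaxPlus.exists_t h0
  rcases lt_trichotomy r 0 with h | h | h
  · obtain ⟨s', -, hs'⟩ := hS.exists_inv (s := ⟨_, ha⟩) rfl
    exact ⟨s', -r, by linarith, hs'⟩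
  · exact absurd (by rw [h, MaxPlus.t_zero]) h1
  · exact ⟨⟨_, ha⟩, r, h, rfl⟩

theorem IsSubsemifield.exists_zpow (hS : IsSubsemifield S) {s : S} {r : ℝ}
    (h : (s : Trop) = MaxPlus.t r) (n : ℤ) : ∃ s' : S, (s' : Trop) = MaxPlus.t (n * r) := by
  have hpow : ∀ (s : S) (r : ℝ), (s : Trop) = MaxPlus.t r → ∀ n : ℕ,
      ((s ^ n : S) : Trop) = MaxPlus.t (n * r) := by
    intro s r h n
    rw [Subsemiring.coe_pow, h, MaxPlus.t_pow, nsmul_eq_mul]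
  rcases n with n | n
  · exact ⟨s ^ n, by simpa using hpow s r h n⟩
  · obtain ⟨s', -, hs'⟩ := hS.exists_inv h
    refine ⟨s' ^ (n + 1), ?_⟩
    rw [hpow s' _ hs' (n + 1), Int.cast_negSucc]
    congr 1
    ring

/-- `S` is unbounded below. -/
theorem IsSubsemifield.exists_lt (hS : IsSubsemifield S) (x : ℝ) :
    ∃ (s : S) (r : ℝ), (s : Trop) = MaxPlus.t r ∧ r < x := by
  obtain ⟨s, r, hr, hs⟩ := hS.exists_pos
  obtain ⟨n, hn⟩ := exists_int_lt (x / r)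
  obtain ⟨s', hs'⟩ := hS.exists_zpow hs n
  exact ⟨s', _, hs', by rwa [← lt_div_iff₀ hr]⟩

end Subsemifield

/-! ### Continuity of prime congruences over `S` -/

section Base

variable {S : Subsemiring Trop} {A : Type u} [CommSemiring A] [Algebra S A] {P : RingCon A}

/-- Since `κ(P)` is a topological semiring, the universal property of the topology on `A` reduces
the continuity of `A → κ(P)` to that of `S → κ(P)`, which says that the units of `S` become
arbitrarily small in `κ(P)`. -/
theorem mem_contBase_iff (hS : IsSubsemifield S) :
    P ∈ ContBase S A ↔ IsPrimeCong P ∧ (∃ x : P.Quotient, x ≠ 0 ∧ x ≠ 1) ∧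
      ∀ a : ResidueSemifield P, a ≠ 0 →
        ∃ s : S, s ≠ 0 ∧ Leq (absv P (algebraMap S A s)) a := by
  have hSK := hS.isTotalSemifield
  constructor
  · intro hP
    have hK := hP.1.isTotalSemifield
    refine ⟨hP.1, hP.2.1, fun a ha => ?_⟩
    have hop := ((IsTotalSemifield.continuous_iff _).1 (continuous_base hP) a (hK.isUnit a ha)).2
    obtain ⟨s, hs, h⟩ := exists_interval hop (by
      simp only [Set.mem_preimage, map_zero]
      exact leq_zero_left a)
    exact ⟨s, hSK.ne_zero hs, h s (leq_refl s)⟩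
  · rintro ⟨hP, hB, h⟩
    have hK := hP.isTotalSemifield
    refine ⟨hP, hB, ?_⟩
    let τ := canonicalTopology (ResidueSemifield P)
    have hts := hK.isTopologicalSemiring
    have hbase : @Continuous _ _ (canonicalTopology S) τ
        (fun s : S => absv P (algebraMap S A s)) := by
      have hpt : ∀ s : S, s ≠ 0 → @IsOpen _ (canonicalTopology S) {s} := fun s hs =>
        IsTotalSemifield.isOpen_singleton (hSK.isUnit s hs)
      let τS := canonicalTopology S
      refine (IsTotalSemifield.continuous_iff _).2 fun a ha => ⟨?_, ?_⟩
      · rw [← Set.biUnion_of_singleton ((fun s : S => absv P (algebraMap S A s)) ⁻¹' {a})]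
        refine isOpen_biUnion fun s hs => hpt s ?_
        rintro rfl
        simp only [Set.mem_preimage, map_zero, Set.mem_singleton_iff] at hs
        exact hK.ne_zero ha hs.symm
      · rw [isOpen_iff_forall_mem_open]
        intro s hs
        by_cases hs0 : s = 0
        · obtain ⟨r, hr, hra⟩ := h a (hK.ne_zero ha)
          refine ⟨{x | Leq x r}, fun x hx => ?_, IsTotalSemifield.isOpen_leq (hSK.isUnit r hr), ?_⟩
          · exact ((hx.map (algebraMap S A)).map (absv P)).trans hra
          · rw [hs0]
            exact leq_zero_left r
        · exact ⟨{s}, Set.singleton_subset_iff.2 hs, hpt s hs0, rfl⟩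
    rw [continuous_iff_le_induced]
    exact sInf_le ⟨ResidueSemifield P, inferInstance, τ, hts, absv P, hbase, rfl⟩

/-- The structure map `S → κ(P)` is injective for `P ∈ Cont_S A`. -/
theorem base_injective (hS : IsSubsemifield S) (hP : P ∈ ContBase S A) :
    Function.Injective ((absv P).comp (algebraMap S A)) := by
  obtain ⟨hpr, ⟨x, hx0, hx1⟩, hsmall⟩ := (mem_contBase_iff hS).1 hP
  have hK := hpr.isTotalSemifield
  have hSK := hS.isTotalSemifield
  set β := (absv P).comp (algebraMap S A) with hβ
  -- If some `t ^ r` with `r > 0` maps to `1`, then every unit of `S` maps above `1`.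
  have key : ∀ (s : S) (r : ℝ), (s : Trop) = MaxPlus.t r → 0 < r → β s ≠ 1 := by
    intro s r hs hr h1
    obtain ⟨a, rfl⟩ := P.mk'_surjective x
    have hone : ∀ y : ResidueSemifield P, y ≠ 0 → Leq 1 y := by
      intro y hy
      obtain ⟨s', hs', hle⟩ := hsmall y hy
      refine Leq.trans ?_ hle
      obtain ⟨r', hr'⟩ := exists_coe_eq_t hs'
      obtain ⟨n, hn⟩ := exists_nat_gt (-r' / r)
      have h2 : Leq 1 (s ^ n * s') := by
        rw [coe_leq_iff, Subsemiring.coe_mul, Subsemiring.coe_pow, hs, hr', MaxPlus.t_pow,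
          ← MaxPlus.t_add]
        change MaxPlus.t 0 ≤ _
        rw [MaxPlus.t_le_t, nsmul_eq_mul]
        rw [div_lt_iff₀ hr] at hn
        linarith
      have h3 := h2.map β
      rw [map_mul, map_pow, h1, one_pow, one_mul, map_one] at h3
      exact h3
    have ha0 : absv P a ≠ 0 := fun h0 => hx0 (quotient_eq_zero_iff.2 h0)
    have ha1 := hK.eq_one_of_forall_one_leq hone ha0
    rw [← map_one (absv P), absv_eq_iff] at ha1
    exact hx1 ((RingCon.eq P).2 ha1)
  have hne : ∀ (s s' : S) (r r' : ℝ), (s : Trop) = MaxPlus.t r → (s' : Trop) = MaxPlus.t r' →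
      r < r' → β s ≠ β s' := by
    intro s s' r r' hs hs' hlt h
    obtain ⟨i, hi, hi'⟩ := hS.exists_inv hs
    refine key (s' * i) (r' + -r) (by rw [Subsemiring.coe_mul, hs', hi', MaxPlus.t_add])
      (by linarith) ?_
    rw [map_mul, ← h, ← map_mul, hi, map_one]
  intro s s' h
  by_cases hs : s = 0
  · by_contra hne'
    have hs' : s' ≠ 0 := fun h' => hne' (by rw [hs, h'])
    apply hSK.map_ne_zero hK β hs'
    rw [← h, hs, map_zero]
  · have hs' : s' ≠ 0 := by
      rintro rfl
      apply hSK.map_ne_zero hK β hs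
      rw [h, map_zero]
    obtain ⟨r, hr⟩ := exists_coe_eq_t hs
    obtain ⟨r', hr'⟩ := exists_coe_eq_t hs'
    rcases lt_trichotomy r r' with hlt | heq | hlt
    · exact absurd h (hne s s' r r' hr hr' hlt)
    · exact Subtype.ext (by rw [hr, hr', heq])
    · exact absurd h.symm (hne s' s r' r hr' hr hlt)

end Base

/-! ### Hahn embeddings over a sub-semifield -/

namespace MaxPlus

variable {G G' : Type*} [AddCommGroup G] [LinearOrder G] [IsOrderedAddMonoid G]
  [AddCommGroup G'] [LinearOrder G'] [IsOrderedAddMonoid G']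

/-- The homomorphism of semifields `G ∪ {-∞} → G' ∪ {-∞}` induced by a homomorphism of ordered
groups. -/
noncomputable def map (f : G →+o G') : MaxPlus G →+* MaxPlus G' where
  toFun := WithBot.map f
  map_zero' := rfl
  map_one' := congrArg t (map_zero f)
  map_add' _ _ := (f.monotone'.withBot_map).map_max
  map_mul' x y := WithBot.map_add f x y

theorem map_t (f : G →+o G') (g : G) : map f (t g) = t (f g) := rfl

theorem map_injective {f : G →+o G'} (hf : Function.Injective f) : Function.Injective (map f) :=
  WithBot.map_injective hf

end MaxPlus

section Coeff

variable {I : Type*} [LinearOrder I] [OrderBot I]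

/-- The coefficient at the least index, which dominates the lexicographic order. -/
noncomputable def botCoeff (I : Type*) [LinearOrder I] [OrderBot I] :
    Lex (HahnSeries I ℝ) →+o ℝ where
  toFun x := (ofLex x).coeff ⊥
  map_zero' := rfl
  map_add' _ _ := rfl
  monotone' x y h := by
    rcases h.eq_or_lt with rfl | h
    · exact le_rfl
    · obtain ⟨i, hi, hlt⟩ := (HahnSeries.lt_iff x y).1 h
      rcases eq_bot_or_bot_lt i with rfl | hb
      · exact hlt.le
      · exact (hi _ hb).le

theorem botCoeff_apply (x : Lex (HahnSeries I ℝ)) : botCoeff I x = (ofLex x).coeff ⊥ := rfl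

theorem lt_of_botCoeff_lt {x y : Lex (HahnSeries I ℝ)} (h : botCoeff I x < botCoeff I y) : x < y :=
  lt_of_not_ge fun h' => h.not_ge ((botCoeff I).monotone' h')

theorem lexIncl_t (r : ℝ) :
    lexIncl I (MaxPlus.t r) = MaxPlus.t (toLex (HahnSeries.single (⊥ : I) r)) := rfl

theorem map_botCoeff_lexIncl (x : Trop) : MaxPlus.map (botCoeff I) (lexIncl I x) = x := by
  by_cases hx : x = 0
  · subst hx
    rfl
  · obtain ⟨r, rfl⟩ := MaxPlus.exists_t hx
    rw [lexIncl_t, MaxPlus.map_t, botCoeff_apply]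
    simp

end Coeff

/-- Two homomorphisms to `ℝ` which have the same positive elements are proportional. -/
theorem exists_pos_mul_eq {G : Type*} [AddCommGroup G] {ρ χ : G →+ ℝ}
    (h : ∀ g, 0 < ρ g → 0 < χ g) {g₀ : G} (h₀ : 0 < ρ g₀) : ∃ c : ℝ, 0 < c ∧ ∀ g, χ g = c * ρ g := by
  have hc : 0 < χ g₀ / ρ g₀ := div_pos (h g₀ h₀) h₀
  set c := χ g₀ / ρ g₀ with hcdef
  have hcg : c * ρ g₀ = χ g₀ := div_mul_cancel₀ _ h₀.ne'
  have key : ∀ g, c * ρ g ≤ χ g := by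
    intro g
    by_contra! hlt
    -- If `χ g < c ρ g`, a large multiple of `g` is separated from the multiples of `g₀`.
    obtain ⟨n, hn⟩ := exists_nat_gt (χ g₀ / (c * ρ g - χ g))
    rw [div_lt_iff₀ (by linarith)] at hn
    let m : ℤ := ⌈(n * ρ g) / ρ g₀⌉ - 1
    have h1 : (m : ℝ) * ρ g₀ < n * ρ g := by
      rw [← lt_div_iff₀ h₀]
      have := Int.ceil_lt_add_one ((n * ρ g) / ρ g₀)
      simp only [m, Int.cast_sub, Int.cast_one]
      linarith
    have h2 : n * ρ g ≤ ((m : ℝ) + 1) * ρ g₀ := by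
      rw [← div_le_iff₀ h₀]
      have := Int.le_ceil ((n * ρ g) / ρ g₀)
      simp only [m, Int.cast_sub, Int.cast_one]
      linarith
    have h3 := h (n • g - m • g₀) (by
      rw [map_sub, map_nsmul, map_zsmul, nsmul_eq_mul, zsmul_eq_mul]
      linarith)
    rw [map_sub, map_nsmul, map_zsmul, nsmul_eq_mul, zsmul_eq_mul] at h3
    have h4 := mul_le_mul_of_nonneg_left h2 hc.le
    have h5 : c * ((m + 1) * ρ g₀) = (m + 1) * χ g₀ := by rw [← hcg]; ring
    nlinarith
  refine ⟨c, hc, fun g => le_antisymm ?_ (key g)⟩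
  have := key (-g)
  rw [map_neg, map_neg] at this
  linarith

/-- The Hahn series with real coefficients form a divisible group. -/
noncomputable instance hahnDivisible (I : Type*) [LinearOrder I] :
    DivisibleBy (HahnSeries I ℝ) ℤ where
  div x n := (n : ℝ)⁻¹ • x
  div_zero x := by
    ext i
    change ((0 : ℤ) : ℝ)⁻¹ * x.coeff i = 0
    rw [Int.cast_zero, inv_zero, zero_mul]
  div_cancel {n} x hn := by
    ext i
    have : (n : ℝ) ≠ 0 := Int.cast_ne_zero.2 hn
    rw [← Int.cast_smul_eq_zsmul ℝ, smul_smul, mul_inv_cancel₀ this, one_smul]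

/-- Hahn's embedding theorem relative to a subgroup of `ℝ`: if the ordered group `K` has a cofinal
subgroup that is isomorphic to a subgroup of `ℝ`, then the Hahn embedding of `K` can be chosen to
extend the given embedding of that subgroup into the factor of the least index. An arbitrary Hahn
embedding is rescaled, and then corrected by an automorphism of the Hahn group that removes the
higher coefficients of the elements of the subgroup. -/
theorem exists_hahn_group {K : Type u} [AddCommGroup K] [LinearOrder K] [IsOrderedAddMonoid K]
    {G : Type*} [AddCommGroup G] (ρ : G →+ ℝ) (β : G →+ K) (hρ : Function.Injective ρ)
    (hpos : ∀ g, 0 < ρ g → 0 < β g) {g₀ : G} (h₀ : 0 < ρ g₀) (hcof : ∀ k, ∃ g, k ≤ β g) :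
    ∃ (I : Type u) (_ : LinearOrder I) (_ : OrderBot I) (f : K →+o Lex (HahnSeries I ℝ)),
      Function.Injective f ∧ ∀ g, f (β g) = toLex (HahnSeries.single ⊥ (ρ g)) := by
  obtain ⟨f₀, hf₀, hclass⟩ := hahnEmbedding_isOrderedAddMonoid K
  have hmono : ∀ g g', ρ g ≤ ρ g' → β g ≤ β g' := by
    intro g g' h
    rcases h.eq_or_lt with h | h
    · rw [hρ h]
    · have := hpos (g' - g) (by rw [map_sub]; linarith)
      rw [map_sub] at this
      exact (sub_pos.1 this).le
  -- A positive element of the subgroup belongs to the dominant Archimedean class.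
  have hdom : ∀ g, 0 < ρ g → ∀ k : K, ArchimedeanClass.mk (β g) ≤ ArchimedeanClass.mk k := by
    intro g hg k
    rw [ArchimedeanClass.mk_le_mk]
    obtain ⟨g', hg'⟩ := hcof |k|
    obtain ⟨n, hn⟩ := exists_nat_ge (ρ g' / ρ g)
    refine ⟨n, hg'.trans ?_⟩
    rw [abs_of_pos (hpos g hg), ← map_nsmul]
    refine hmono _ _ ?_
    rw [map_nsmul, nsmul_eq_mul]
    exact (div_le_iff₀ hg).1 hn
  let I := FiniteArchimedeanClass K
  have hβ₀ : β g₀ ≠ 0 := (hpos g₀ h₀).ne'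
  let _ : OrderBot I :=
    { bot := FiniteArchimedeanClass.mk (β g₀) hβ₀
      bot_le := by
        intro a
        induction a using FiniteArchimedeanClass.ind with
        | mk a ha => exact hdom g₀ h₀ a }
  let χ : G →+ ℝ := ((botCoeff I : Lex (HahnSeries I ℝ) →+ ℝ).comp (f₀ : K →+ _)).comp β
  have hχ : ∀ g, 0 < ρ g → 0 < χ g := by
    intro g hg
    have hβ : 0 < β g := hpos g hg
    have hf : 0 < f₀ (β g) := by
      refine lt_of_le_of_ne ?_ ?_
      · rw [← map_zero f₀]
        exact f₀.monotone' hβ.le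
      · intro h
        rw [← map_zero f₀] at h
        exact hβ.ne (hf₀ h)
    have hord : (ofLex (f₀ (β g))).orderTop = ((⊥ : I) : WithTop I) := by
      apply (FiniteArchimedeanClass.withTopOrderIso K).injective
      rw [← hclass, FiniteArchimedeanClass.withTopOrderIso_apply_coe]
      exact le_antisymm (hdom g hg _) (hdom g₀ h₀ _)
    have hlead := HahnSeries.leadingCoeff_pos_iff.2 hf
    have hne : ofLex (f₀ (β g)) ≠ 0 := fun h => hf.ne' h
    have : (ofLex (f₀ (β g))).leadingCoeff = (ofLex (f₀ (β g))).coeff ⊥ := by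
      rw [HahnSeries.leadingCoeff_of_ne_zero hne]
      congr 1
      rw [WithTop.untop_eq_iff]
      exact hord
    rw [this] at hlead
    exact hlead
  obtain ⟨c, hc, hχc⟩ := exists_pos_mul_eq hχ h₀
  -- the rescaled embedding
  let f₁ : K →+ HahnSeries I ℝ :=
    { toFun := fun k => c⁻¹ • ofLex (f₀ k)
      map_zero' := by simp
      map_add' := fun x y => by rw [map_add, ofLex_add, smul_add] }
  have hf₁ : ∀ k, (f₁ k).coeff ⊥ = c⁻¹ * botCoeff I (f₀ k) := fun k => rfl
  have hf₁β : ∀ g, (f₁ (β g)).coeff ⊥ = ρ g := by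
    intro g
    rw [hf₁]
    change c⁻¹ * χ g = ρ g
    rw [hχc, ← mul_assoc, inv_mul_cancel₀ hc.ne', one_mul]
  -- the higher coefficients of the elements of the subgroup, extended to `ℝ`
  obtain ⟨T, hT⟩ := (Module.Baer.of_divisible (HahnSeries I ℝ)).extension_property_addMonoidHom
    ρ hρ (f₁.comp β - (HahnSeries.single.addMonoidHom (⊥ : I)).comp ρ)
  have hTρ : ∀ g, T (ρ g) = f₁ (β g) - HahnSeries.single ⊥ (ρ g) := fun g =>
    DFunLike.congr_fun hT g
  let χ₁ : K →+ ℝ := (HahnSeries.coeff.addMonoidHom (⊥ : I)).comp f₁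
  have hχ₁ : ∀ k, χ₁ k = (f₁ k).coeff ⊥ := fun k => rfl
  let f₂ : K →+ HahnSeries I ℝ := f₁ - T.comp χ₁ + (HahnSeries.single.addMonoidHom (⊥ : I)).comp
    ((HahnSeries.coeff.addMonoidHom (⊥ : I)).comp (T.comp χ₁))
  have hf₂ : ∀ k, f₂ k = f₁ k - T (χ₁ k) + HahnSeries.single ⊥ ((T (χ₁ k)).coeff ⊥) :=
    fun k => rfl
  have hf₂bot : ∀ k, (f₂ k).coeff ⊥ = χ₁ k := by
    intro k
    rw [hf₂, HahnSeries.coeff_add, HahnSeries.coeff_sub, HahnSeries.coeff_single_same, hχ₁]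
    ring
  have hstrict : ∀ k, 0 < k → 0 < toLex (f₂ k) := by
    intro k hk
    have hf₀k : 0 < f₀ k := by
      refine lt_of_le_of_ne ?_ fun h => hk.ne (hf₀ (by rw [map_zero, h]))
      rw [← map_zero f₀]
      exact f₀.monotone' hk.le
    have hnn : 0 ≤ χ₁ k := by
      rw [hχ₁, hf₁]
      refine mul_nonneg (inv_pos.2 hc).le ?_
      rw [← map_zero (botCoeff I)]
      exact (botCoeff I).monotone' hf₀k.le
    rcases hnn.eq_or_lt with h | h
    · have : f₂ k = f₁ k := by
        rw [hf₂, ← h, map_zero, HahnSeries.coeff_zero, map_zero, sub_zero, add_zero]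
      rw [this]
      obtain ⟨i, hi, hlt⟩ := (HahnSeries.lt_iff _ _).1 hf₀k
      refine (HahnSeries.lt_iff _ _).2 ⟨i, fun j hj => ?_, ?_⟩
      · change 0 = c⁻¹ * (ofLex (f₀ k)).coeff j
        rw [← hi j hj]
        change 0 = c⁻¹ * 0
        rw [mul_zero]
      · exact mul_pos (inv_pos.2 hc) hlt
    · refine lt_of_botCoeff_lt ?_
      rw [map_zero, botCoeff_apply]
      change 0 < (f₂ k).coeff ⊥
      rwa [hf₂bot]
  refine ⟨I, inferInstance, inferInstance,
    { toFun := fun k => toLex (f₂ k)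
      map_zero' := by rw [map_zero, toLex_zero]
      map_add' := fun x y => by rw [map_add, toLex_add]
      monotone' := ?_ }, ?_, ?_⟩
  · intro x y hxy
    rcases hxy.eq_or_lt with rfl | h
    · exact le_rfl
    · have := hstrict (y - x) (sub_pos.2 h)
      rw [map_sub, toLex_sub] at this
      exact (sub_pos.1 this).le
  · intro x y hxy
    by_contra hne
    have hxy' : f₂ x = f₂ y := toLex.injective hxy
    rcases lt_or_gt_of_ne hne with h | h
    · have := hstrict (y - x) (sub_pos.2 h)
      rw [map_sub, hxy', sub_self] at this
      exact lt_irrefl _ this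
    · have := hstrict (x - y) (sub_pos.2 h)
      rw [map_sub, hxy', sub_self] at this
      exact lt_irrefl _ this
  · intro g
    change toLex (f₂ (β g)) = _
    rw [hf₂, hχ₁, hf₁β, hTρ, HahnSeries.coeff_sub, hf₁β, HahnSeries.coeff_single_same, sub_self,
      map_zero, add_zero, sub_sub_cancel]

/-- The order on the group of units of a totally ordered semifield. -/
@[reducible]
noncomputable def IsTotalSemifield.unitsOrder {K : Type*} [CommSemiring K]
    (hK : IsTotalSemifield K) : LinearOrder (Additive Kˣ) where
  le a b := Leq (a.toMul : K) (b.toMul : K)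
  le_refl a := hK.leq_refl _
  le_trans _ _ _ h h' := h.trans h'
  le_antisymm _ _ h h' := Additive.toMul.injective (Units.ext (h.antisymm h'))
  le_total a b := hK.total _ _
  toDecidableLE := Classical.decRel _

/-- A homomorphism of ordered groups from the units of a totally ordered semifield extends to a
homomorphism of semifields. -/
theorem IsTotalSemifield.exists_extend_units {K : Type*} [CommSemiring K] (hK : IsTotalSemifield K)
    {G : Type*} [AddCommGroup G] [LinearOrder G] [IsOrderedAddMonoid G] (f : Additive Kˣ →+ G)
    (hmono : ∀ a b : Kˣ, Leq (a : K) b → f (.ofMul a) ≤ f (.ofMul b))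
    (hinj : Function.Injective f) :
    ∃ φ : K →+* MaxPlus G, Function.Injective φ ∧ ∀ a : Kˣ, φ a = MaxPlus.t (f (.ofMul a)) := by
  classical
  let φ : K → MaxPlus G := fun x => if h : IsUnit x then MaxPlus.t (f (.ofMul h.unit)) else 0
  have hu : ∀ a : Kˣ, φ a = MaxPlus.t (f (.ofMul a)) := by
    intro a
    simp only [φ]
    rw [dif_pos a.isUnit]
    congr
    exact Units.ext rfl
  have h0 : φ 0 = 0 := dif_neg fun h => hK.ne_zero h rfl
  have hcase : ∀ x : K, x = 0 ∨ ∃ a : Kˣ, (a : K) = x := by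
    intro x
    by_cases hx : x = 0
    · exact Or.inl hx
    · exact Or.inr ((hK.isUnit x hx).imp fun _ h => h)
  have hle : ∀ x y : K, Leq x y → φ x ≤ φ y := by
    intro x y h
    rcases hcase x with rfl | ⟨a, rfl⟩
    · rw [h0]
      exact MaxPlus.zero_le' _
    · rcases hcase y with rfl | ⟨b, rfl⟩
      · exact absurd h (IsTotalSemifield.not_leq_zero (hK.ne_zero a.isUnit))
      · rw [hu, hu, MaxPlus.t_le_t]
        exact hmono a b h
  refine ⟨⟨⟨⟨φ, ?_⟩, ?_⟩, h0, ?_⟩, ?_, hu⟩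
  · rw [← Units.val_one, hu]
    exact congrArg MaxPlus.t (map_zero f)
  · intro x y
    rcases hcase x with rfl | ⟨a, rfl⟩
    · change φ (0 * y) = φ 0 * φ y
      rw [zero_mul, h0, zero_mul]
    · rcases hcase y with rfl | ⟨b, rfl⟩
      · change φ (a * 0) = φ a * φ 0
        rw [mul_zero, h0, mul_zero]
      · change φ (a * b) = φ a * φ b
        rw [← Units.val_mul, hu, hu, hu, ofMul_mul, map_add, MaxPlus.t_add]
  · intro x y
    change φ (x + y) = φ x + φ y
    rcases hK.total x y with h | h
    · rw [show x + y = y from h, (MaxPlus.leq_iff_le _ _).2 (hle x y h)]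
    · rw [add_comm, show y + x = x from h, add_comm, (MaxPlus.leq_iff_le _ _).2 (hle y x h)]
  · intro x y hxy
    change φ x = φ y at hxy
    rcases hcase x with rfl | ⟨a, rfl⟩
    · rcases hcase y with rfl | ⟨b, rfl⟩
      · rfl
      · rw [h0, hu] at hxy
        exact absurd hxy.symm (MaxPlus.t_ne_zero _)
    · rcases hcase y with rfl | ⟨b, rfl⟩
      · rw [h0, hu] at hxy
        exact absurd hxy (MaxPlus.t_ne_zero _)
      · rw [hu, hu] at hxy
        rw [Additive.ofMul.injective (hinj (MaxPlus.t_injective hxy))]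

section Base

variable {S : Subsemiring Trop} {A : Type u} [CommSemiring A] [Algebra S A] {P : RingCon A}

/-- The residue semifield of an element of `Cont_S A` has a Hahn embedding over `S`. -/
theorem exists_hahn (hS : IsSubsemifield S) (hP : P ∈ ContBase S A) :
    ∃ (I : Type u) (_ : LinearOrder I) (_ : OrderBot I) (φ : ResidueSemifield P →+* LexSemifield I),
      Function.Injective φ ∧ ∀ s : S, φ (absv P (algebraMap S A s)) = lexIncl I s := by
  have hSK := hS.isTotalSemifield
  have hK := hP.1.isTotalSemifield
  have hsmall := ((mem_contBase_iff hS).1 hP).2.2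
  have hbase := base_injective hS hP
  let β' : S →+* ResidueSemifield P := (absv P).comp (algebraMap S A)
  let _ := hK.unitsOrder
  have : IsOrderedAddMonoid (Additive (ResidueSemifield P)ˣ) :=
    { add_le_add_left := fun a b h c => by
        change Leq (((a + c).toMul : (ResidueSemifield P)ˣ) : ResidueSemifield P)
          (((b + c).toMul : (ResidueSemifield P)ˣ) : ResidueSemifield P)
        rw [toMul_add, toMul_add, Units.val_mul, Units.val_mul]
        exact Leq.mul_right h _ }
  let β : Additive Sˣ →+ Additive (ResidueSemifield P)ˣ :=
    MonoidHom.toAdditive (Units.map (β' : S →* ResidueSemifield P))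
  have hβ : ∀ s : Sˣ, (((β (.ofMul s)).toMul : (ResidueSemifield P)ˣ) : ResidueSemifield P) =
    β' s := fun s => rfl
  have hex : ∀ s : Additive Sˣ, ∃ r : ℝ, ((s.toMul : S) : Trop) = MaxPlus.t r := fun s =>
    exists_coe_eq_t (hSK.ne_zero s.toMul.isUnit)
  choose ρ' hρ' using hex
  let ρ : Additive Sˣ →+ ℝ :=
    { toFun := ρ'
      map_zero' := MaxPlus.t_injective (by rw [← hρ']; rfl)
      map_add' := fun a b => MaxPlus.t_injective (by
        rw [← hρ', MaxPlus.t_add, ← hρ', ← hρ', toMul_add]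
        rfl) }
  have hρ : ∀ s : Additive Sˣ, ((s.toMul : S) : Trop) = MaxPlus.t (ρ s) := hρ'
  have hρinj : Function.Injective ρ := by
    intro a b h
    refine Additive.toMul.injective (Units.ext (Subtype.ext ?_))
    rw [hρ, hρ, h]
  have hmono : ∀ a b : Additive Sˣ, ρ a ≤ ρ b → β a ≤ β b := by
    intro a b h
    have : Leq ((a.toMul : S)) (b.toMul : S) := by
      rw [coe_leq_iff, hρ, hρ, MaxPlus.t_le_t]
      exact h
    exact this.map β'
  have hβinj : Function.Injective β := by
    intro a b h
    refine Additive.toMul.injective (Units.ext (hbase ?_))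
    exact congrArg (fun x => ((x.toMul : (ResidueSemifield P)ˣ) : ResidueSemifield P)) h
  have hunit : ∀ s : S, s ≠ 0 → ∃ a : Additive Sˣ, (a.toMul : S) = s := by
    intro s hs
    obtain ⟨a, rfl⟩ := hSK.isUnit s hs
    exact ⟨.ofMul a, rfl⟩
  obtain ⟨s₀, r₀, hr₀, hs₀⟩ := hS.exists_pos
  obtain ⟨g₀, hg₀⟩ := hunit s₀ (ne_zero_of_coe_eq_t hs₀)
  have hg₀' : 0 < ρ g₀ := by
    have := hρ g₀
    rw [hg₀, hs₀] at this
    rwa [← MaxPlus.t_injective this]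
  obtain ⟨I, iI, iB, f, hf, hfβ⟩ := exists_hahn_group ρ β hρinj (by
    intro g hg
    refine lt_of_le_of_ne ?_ ?_
    · rw [← map_zero β]
      exact hmono _ _ (by rw [map_zero]; exact hg.le)
    · intro h
      rw [← map_zero β] at h
      rw [← hβinj h, map_zero] at hg
      exact lt_irrefl _ hg) hg₀' (by
    intro k
    obtain ⟨s, hs, hle⟩ := hsmall _ (hK.ne_zero (-k).toMul.isUnit)
    obtain ⟨a, rfl⟩ := hunit s hs
    have h1 : β a ≤ -k := hle
    refine ⟨-a, ?_⟩
    rw [map_neg]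
    exact le_neg_of_le_neg h1)
  obtain ⟨φ, hφ, hφf⟩ := hK.exists_extend_units f.toAddMonoidHom
    (fun a b h => f.monotone' h) hf
  refine ⟨I, iI, iB, φ, hφ, fun s => ?_⟩
  by_cases hs : s = 0
  · subst hs
    rw [map_zero, map_zero, map_zero]
    rfl
  · obtain ⟨a, rfl⟩ := hunit s hs
    have h1 := hφf ((β a).toMul)
    have h2 : ((a.toMul : S) : Trop) = MaxPlus.t (ρ a) := hρ a
    rw [h2, lexIncl_t, ← hfβ]
    exact h1

/-- Two elements of `Cont_S A` have a common Hahn embedding, with index set the lexicographic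
product of index sets for the two residue semifields. -/
theorem exists_jointHahnEmbedding (hS : IsSubsemifield S) (hP : P ∈ ContBase S A) {P' : RingCon A}
    (hP' : P' ∈ ContBase S A) : ∃ (I : Type u) (_ : LinearOrder I) (_ : OrderBot I),
      Nonempty (JointHahnEmbedding (S := S) P P' I) := by
  obtain ⟨I, _, _, φ, hφ, hφS⟩ := exists_hahn hS hP
  obtain ⟨I', _, _, φ', hφ', hφS'⟩ := exists_hahn hS hP'
  let e : I ↪o I ×ₗ I' := OrderEmbedding.ofStrictMono (fun i => toLex (i, ⊥)) fun i j h =>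
    Prod.Lex.toLex_lt_toLex.2 (Or.inl h)
  let e' : I' ↪o I ×ₗ I' := OrderEmbedding.ofStrictMono (fun i => toLex (⊥, i)) fun i j h =>
    Prod.Lex.toLex_lt_toLex.2 (Or.inr ⟨rfl, h⟩)
  have key : ∀ {J : Type u} [LinearOrder J] [OrderBot J] (e : J ↪o I ×ₗ I'), e ⊥ = ⊥ →
      ∀ x : Trop, MaxPlus.map (HahnSeries.embDomainOrderAddMonoidHom e) (lexIncl J x) =
        lexIncl (I ×ₗ I') x := by
    intro J _ _ e he x
    by_cases hx : x = 0
    · subst hx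
      rfl
    · obtain ⟨r, rfl⟩ := MaxPlus.exists_t hx
      rw [lexIncl_t, lexIncl_t, MaxPlus.map_t]
      congr 1
      change toLex (HahnSeries.embDomain e (HahnSeries.single ⊥ r)) = _
      rw [HahnSeries.embDomain_single, he]
  exact ⟨I ×ₗ I', inferInstance, inferInstance, ⟨{
    left := (MaxPlus.map (HahnSeries.embDomainOrderAddMonoidHom e)).comp φ
    right := (MaxPlus.map (HahnSeries.embDomainOrderAddMonoidHom e')).comp φ'
    left_injective :=
      (MaxPlus.map_injective (HahnSeries.embDomainOrderAddMonoidHom_injective e)).comp hφ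
    right_injective :=
      (MaxPlus.map_injective (HahnSeries.embDomainOrderAddMonoidHom_injective e')).comp hφ'
    left_base := fun s => by rw [RingHom.comp_apply, hφS]; exact key e rfl s
    right_base := fun s => by rw [RingHom.comp_apply, hφS']; exact key e' rfl s }⟩⟩

end Base

/-! ### Tropicalizations and the map `Φ` -/

/-- A tropicalization of `P` over `S`: a homomorphism to `𝕋` which extends the inclusion of `S` and
factors through the quotient by `P`. -/
structure IsTropicalization {S : Subsemiring Trop} {A : Type*} [CommSemiring A] [Algebra S A]
    (P : RingCon A) (φ : A →+* Trop) : Prop where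
  le_ker : P ≤ RingCon.ker φ
  base : ∀ s : S, φ (algebraMap S A s) = s

section Base

variable {S : Subsemiring Trop} {A : Type u} [CommSemiring A] [Algebra S A] {P : RingCon A}

theorem exists_isTropicalization (hS : IsSubsemifield S) (hP : P ∈ ContBase S A) :
    ∃ φ : A →+* Trop, IsTropicalization (S := S) P φ := by
  obtain ⟨I, _, _, h, -, hb⟩ := exists_hahn hS hP
  refine ⟨((MaxPlus.map (botCoeff I)).comp h).comp (absv P), ?_, fun s => ?_⟩
  · intro a b hab
    simp only [RingCon.ker_apply, RingHom.comp_apply, absv_eq_iff.2 hab]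
  · rw [RingHom.comp_apply, RingHom.comp_apply, hb, map_botCoeff_lexIncl]

namespace IsTropicalization

variable {φ : A →+* Trop}

theorem map_eq (hφ : IsTropicalization (S := S) P φ) {a b : A} (h : absv P a = absv P b) :
    φ a = φ b :=
  (RingCon.ker_apply φ).1 (hφ.le_ker (absv_eq_iff.1 h))

theorem le_of_leq (hφ : IsTropicalization (S := S) P φ) {a b : A}
    (h : Leq (absv P a) (absv P b)) : φ a ≤ φ b := by
  rw [← MaxPlus.leq_iff_le]
  unfold Leq
  rw [← map_add]
  refine hφ.map_eq ?_
  rw [map_add]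
  exact h

theorem leq_of_lt (hφ : IsTropicalization (S := S) P φ) (hP : IsPrimeCong P) {a b : A}
    (h : φ a < φ b) : Leq (absv P a) (absv P b) :=
  (hP.isTotalSemifield.total _ _).resolve_right fun h' => h.not_ge (hφ.le_of_leq h')

theorem ne_zero (hφ : IsTropicalization (S := S) P φ) (hS : IsSubsemifield S)
    (hP : P ∈ ContBase S A) {a : A} (h : absv P a ≠ 0) : φ a ≠ 0 := by
  obtain ⟨s, hs, hle⟩ := ((mem_contBase_iff hS).1 hP).2.2 _ h
  have := hφ.le_of_leq hle
  rw [hφ.base] at this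
  obtain ⟨r, hr⟩ := exists_coe_eq_t hs
  rw [hr] at this
  exact ((MaxPlus.zero_lt_t r).trans_le this).ne'

theorem eq_zero (hφ : IsTropicalization (S := S) P φ) {a : A} (h : absv P a = 0) : φ a = 0 := by
  rw [← map_zero φ]
  exact hφ.map_eq (by rw [h, map_zero])

/-- Tropicalizations are unique: if two of them differed at `a`, an element of `S` would lie
strictly between their values at some power of `a`, and could not be compared with that power. -/
theorem unique (hS : IsSubsemifield S) (hP : P ∈ ContBase S A) {ψ : A →+* Trop}
    (hφ : IsTropicalization (S := S) P φ) (hψ : IsTropicalization (S := S) P ψ) : φ = ψ := by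
  have key : ∀ {φ ψ : A →+* Trop}, IsTropicalization (S := S) P φ →
      IsTropicalization (S := S) P ψ → ∀ a, φ a ≤ ψ a := by
    intro φ ψ hφ hψ a
    by_cases ha : absv P a = 0
    · rw [hφ.eq_zero ha]
      exact MaxPlus.zero_le' _
    obtain ⟨x, hx⟩ := MaxPlus.exists_t (hφ.ne_zero hS hP ha)
    obtain ⟨y, hy⟩ := MaxPlus.exists_t (hψ.ne_zero hS hP ha)
    rw [hx, hy, MaxPlus.t_le_t]
    by_contra! hlt
    obtain ⟨s, r, hr, hs⟩ := hS.exists_pos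
    obtain ⟨n, hn⟩ := exists_nat_gt (r / (x - y))
    rw [div_lt_iff₀ (by linarith)] at hn
    let m : ℤ := ⌊n * y / r⌋ + 1
    have h1 : n * y < m * r := by
      rw [← div_lt_iff₀ hr]
      have := Int.lt_floor_add_one (n * y / r)
      simp only [m, Int.cast_add, Int.cast_one]
      exact this
    have h2 : m * r < n * x := by
      have := Int.floor_le (n * y / r)
      rw [le_div_iff₀ hr] at this
      simp only [m, Int.cast_add, Int.cast_one]
      linarith
    obtain ⟨s', hs'⟩ := hS.exists_zpow hs m
    have hφn : φ (a ^ n) = MaxPlus.t (n * x) := by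
      rw [map_pow, hx, MaxPlus.t_pow, nsmul_eq_mul]
    have hψn : ψ (a ^ n) = MaxPlus.t (n * y) := by
      rw [map_pow, hy, MaxPlus.t_pow, nsmul_eq_mul]
    rcases hP.1.isTotalSemifield.total (absv P (algebraMap S A s')) (absv P (a ^ n)) with h | h
    · have := hψ.le_of_leq h
      rw [hψ.base, hs', hψn, MaxPlus.t_le_t] at this
      linarith
    · have := hφ.le_of_leq h
      rw [hφ.base, hs', hφn, MaxPlus.t_le_t] at this
      linarith
  exact RingHom.ext fun a => le_antisymm (key hφ hψ a) (key hψ hφ a)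

end IsTropicalization

/-- The kernel of a homomorphism to `𝕋` over `S` belongs to `Cont_S A`. -/
theorem ker_mem_contBase (hS : IsSubsemifield S) {φ : A →+* Trop}
    (hφ : ∀ s : S, φ (algebraMap S A s) = s) : RingCon.ker φ ∈ ContBase S A := by
  have hT := MaxPlus.isTotalSemifield ℝ
  have hker : ∀ a b, RingCon.ker φ a b ↔ φ a = φ b := fun a b => RingCon.ker_apply φ
  obtain ⟨j, hj, hjφ⟩ := hT.exists_residue_lift hker
  refine (mem_contBase_iff hS).2 ⟨hT.isPrimeCong hker, ?_, fun a ha => ?_⟩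
  · obtain ⟨s, r, hr, hs⟩ := hS.exists_pos
    refine ⟨((algebraMap S A s : A) : (RingCon.ker φ).Quotient), fun h => ?_, fun h => ?_⟩
    · have := (hker _ _).1 ((RingCon.eq _).1 h)
      rw [hφ, map_zero, hs] at this
      exact MaxPlus.t_ne_zero r this
    · have := (hker _ _).1 ((RingCon.eq _).1 h)
      rw [hφ, map_one, hs, ← MaxPlus.t_zero] at this
      exact hr.ne' (MaxPlus.t_injective this)
  · obtain ⟨x, hx⟩ := MaxPlus.exists_t (x := j a) fun h => ha (hj (by rw [h, map_zero]))
    obtain ⟨s, r, hs, hr⟩ := hS.exists_lt x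
    refine ⟨s, ne_zero_of_coe_eq_t hs, (leq_map_iff hj).1 ?_⟩
    rw [hjφ, hφ, hs, hx, MaxPlus.leq_iff_le, MaxPlus.t_le_t]
    exact hr.le

end Base

section Phi

variable {S : Subsemiring Trop} {Λ : Type u} [AddCommGroup Λ] {σ : PointedCone ℝ (Λ →+ ℝ)}
  {P : RingCon (AddMonoidAlgebra S (toricMonoid σ))}
  {φ : AddMonoidAlgebra S (toricMonoid σ) →+* Trop}

/-- The tropical points of `P` are the restrictions to `M` of its tropicalization; the maximal
element of `Cont_S S[M]` above `P` is the kernel of the tropicalization. -/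
theorem isTropicalPoint_iff (hS : IsSubsemifield S)
    (hP : P ∈ ContBase S (AddMonoidAlgebra S (toricMonoid σ)))
    (hφ : IsTropicalization (S := S) P φ) (w : TropicalToric σ) :
    IsTropicalPoint P w ↔
      ∀ u, w (Multiplicative.ofAdd u) = φ (AddMonoidAlgebra.single u 1) := by
  constructor
  · rintro ⟨Pmax, -, hle, e, -, he, hw⟩ u
    have hψ : IsTropicalization (S := S) P (e.comp (absv Pmax)) := by
      refine ⟨fun {a b} hab => ?_, he⟩
      rw [RingCon.ker_apply, RingHom.comp_apply, RingHom.comp_apply, absv_eq_iff.2 (hle hab)]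
    rw [hw, hφ.unique hS hP hψ, RingHom.comp_apply]
  · intro hw
    obtain ⟨e, he, heφ⟩ := (MaxPlus.isTotalSemifield ℝ).exists_residue_lift
      (P := RingCon.ker φ) (N := φ) fun a b => RingCon.ker_apply φ
    refine ⟨RingCon.ker φ, ⟨ker_mem_contBase hS hφ.base, fun P' hP' hle => ?_⟩, hφ.le_ker, e, he,
      fun s => by rw [heφ, hφ.base], fun u => by rw [heφ, hw]⟩
    obtain ⟨ψ, hψ⟩ := exists_isTropicalization hS hP'
    have : φ = ψ := hφ.unique hS hP ⟨(hφ.le_ker.trans hle).trans hψ.le_ker, hψ.base⟩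
    rw [this]
    exact hψ.le_ker

theorem existsUnique_isTropicalPoint (hS : IsSubsemifield S)
    (hP : P ∈ ContBase S (AddMonoidAlgebra S (toricMonoid σ))) :
    ∃! w, IsTropicalPoint P w := by
  obtain ⟨φ, hφ⟩ := exists_isTropicalization hS hP
  refine ⟨(φ : _ →* Trop).comp (AddMonoidAlgebra.of S (toricMonoid σ)), ?_, fun w hw => ?_⟩
  · exact (isTropicalPoint_iff hS hP hφ _).2 fun u => rfl
  · exact MonoidHom.ext fun u => (isTropicalPoint_iff hS hP hφ w).1 hw u.toAdd

theorem Phi_apply (hS : IsSubsemifield S)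
    (hP : P ∈ ContBase S (AddMonoidAlgebra S (toricMonoid σ)))
    (hφ : IsTropicalization (S := S) P φ) (u : toricMonoid σ) :
    Phi P (Multiplicative.ofAdd u) = φ (AddMonoidAlgebra.single u 1) :=
  (isTropicalPoint_iff hS hP hφ _).1
    (Classical.epsilon_spec (existsUnique_isTropicalPoint hS hP).exists) u

end Phi

section Term

variable {S : Subsemiring Trop} {M : Type u} [AddCommMonoid M]
  {P : RingCon (AddMonoidAlgebra S M)} {φ : AddMonoidAlgebra S M →+* Trop}

theorem single_eq_algebraMap_mul (u : M) (a : S) :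
    (AddMonoidAlgebra.single u a : AddMonoidAlgebra S M) =
      algebraMap S _ a * AddMonoidAlgebra.single u 1 := by
  rw [AddMonoidAlgebra.coe_algebraMap, Function.comp_apply, AddMonoidAlgebra.single_mul_single,
    zero_add, Algebra.algebraMap_self, RingHom.id_apply, mul_one]

theorem IsTropicalization.single (hφ : IsTropicalization (S := S) P φ) (u : M) (a : S) :
    φ (AddMonoidAlgebra.single u a) = a * φ (AddMonoidAlgebra.single u 1) := by
  rw [single_eq_algebraMap_mul, map_mul, hφ.base]

/-- Domination of tropicalizations on monomials extends to terms. -/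
theorem IsTropicalization.single_le (hφ : IsTropicalization (S := S) P φ)
    {P' : RingCon (AddMonoidAlgebra S M)} {ψ : AddMonoidAlgebra S M →+* Trop}
    (hψ : IsTropicalization (S := S) P' ψ)
    (h : ∀ u : M, ψ (AddMonoidAlgebra.single u 1) ≤ φ (AddMonoidAlgebra.single u 1))
    (u : M) (a : S) :
    ψ (AddMonoidAlgebra.single u a) ≤ φ (AddMonoidAlgebra.single u a) := by
  rw [hφ.single, hψ.single, ← MaxPlus.leq_iff_le]
  exact ((MaxPlus.leq_iff_le _ _).2 (h u)).mul_left _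

end Term

/-! ### Values of terms and the topology of the semiring of convergent series -/

section Greatest

variable {K : Type*} [CommSemiring K] {ι : Type*}

theorem IsTotalSemifield.exists_greatest_of_finite (hK : IsTotalSemifield K) {s : Set ι}
    (hs : s.Finite) (hne : s.Nonempty) (f : ι → K) : ∃ i ∈ s, ∀ j ∈ s, Leq (f j) (f i) := by
  induction s, hs using Set.Finite.induction_on with
  | empty => exact absurd hne Set.not_nonempty_empty
  | @insert a s _ _ ih =>
    rcases s.eq_empty_or_nonempty with rfl | hs'
    · refine ⟨a, Set.mem_insert _ _, fun j hj => ?_⟩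
      rcases hj with rfl | hj
      · exact hK.leq_refl _
      · exact absurd hj (Set.notMem_empty j)
    · obtain ⟨i, hi, h⟩ := ih hs'
      rcases hK.total (f a) (f i) with h' | h'
      · refine ⟨i, Set.mem_insert_of_mem _ hi, fun j hj => ?_⟩
        rcases hj with rfl | hj
        exacts [h', h j hj]
      · refine ⟨a, Set.mem_insert _ _, fun j hj => ?_⟩
        rcases hj with rfl | hj
        exacts [hK.leq_refl _, (h j hj).trans h']

theorem IsTotalSemifield.exists_greatest (hK : IsTotalSemifield K) {s : Set ι} {f : ι → K} {i : ι}
    (hi : i ∈ s) (hfin : {j | Leq (f i) (f j)}.Finite) : ∃ i ∈ s, ∀ j ∈ s, Leq (f j) (f i) := by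
  obtain ⟨k, hk, h⟩ := hK.exists_greatest_of_finite (hfin.inter_of_right s)
    ⟨i, hi, hK.leq_refl _⟩ f
  refine ⟨k, hk.1, fun j hj => ?_⟩
  rcases hK.total (f j) (f i) with h' | h'
  · exact h'.trans hk.2
  · exact h j ⟨hj, h'⟩

theorem IsTotalSemifield.leq_add_iff (hK : IsTotalSemifield K) {x y z : K} :
    Leq x (y + z) ↔ Leq x y ∨ Leq x z := by
  constructor
  · intro h
    rcases hK.total y z with h' | h'
    · exact Or.inr (by rwa [show y + z = z from h'] at h)
    · exact Or.inl (by rwa [add_comm, show z + y = y from h'] at h)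
  · rintro (h | h)
    · exact h.trans (hK.leq_add_left y z)
    · exact h.trans (hK.leq_add_right y z)

theorem IsTotalSemifield.exists_leq_of_leq_sum (hK : IsTotalSemifield K) {x : K} (hx : x ≠ 0)
    {F : Finset ι} {f : ι → K} (h : Leq x (∑ i ∈ F, f i)) : ∃ i ∈ F, Leq x (f i) := by
  classical
  induction F using Finset.induction_on with
  | empty =>
    rw [Finset.sum_empty] at h
    exact absurd h (not_leq_zero hx)
  | insert a F ha ih =>
    rw [Finset.sum_insert ha] at h
    rcases hK.leq_add_iff.1 h with h | h
    · exact ⟨a, Finset.mem_insert_self _ _, h⟩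
    · obtain ⟨i, hi, h⟩ := ih h
      exact ⟨i, Finset.mem_insert_of_mem hi, h⟩

theorem IsTotalSemifield.leq_and_ne_iff (hK : IsTotalSemifield K) {x r : K} :
    Leq x r ∧ x ≠ r ↔ ¬ Leq r x :=
  ⟨fun h h' => h.2 (h.1.antisymm h'), fun h => ⟨(hK.total x r).resolve_right h, by
    rintro rfl
    exact h (hK.leq_refl x)⟩⟩

/-- Outside the Boolean semifield there is no least nonzero element. -/
theorem IsTotalSemifield.exists_not_leq (hK : IsTotalSemifield K) (h : ∃ x : K, x ≠ 0 ∧ x ≠ 1)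
    {y : K} (hy : y ≠ 0) : ∃ a : K, a ≠ 0 ∧ ¬ Leq y a := by
  obtain ⟨x, hx0, hx1⟩ := h
  by_contra! hall
  refine hx1 (hK.eq_one_of_forall_one_leq (fun a ha => ?_) hx0)
  refine hK.leq_of_mul_right hy ?_
  rw [one_mul]
  exact hall _ (hK.mul_ne_zero ha hy)

end Greatest

theorem exists_residue_ne {A : Type*} [CommSemiring A] {P : RingCon A}
    (h : ∃ x : P.Quotient, x ≠ 0 ∧ x ≠ 1) : ∃ x : ResidueSemifield P, x ≠ 0 ∧ x ≠ 1 := by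
  obtain ⟨x, h0, h1⟩ := h
  have hinj := algebraMap_residue_injective P
  exact ⟨algebraMap _ _ x, fun h => h0 (hinj (by rw [h, map_zero])),
    fun h => h1 (hinj (by rw [h, map_one]))⟩

theorem exists_base_not_leq {S : Subsemiring Trop} {A : Type u} [CommSemiring A] [Algebra S A]
    {P : RingCon A} (hS : IsSubsemifield S) (hP : P ∈ ContBase S A) {y : ResidueSemifield P}
    (hy : y ≠ 0) : ∃ s : S, s ≠ 0 ∧ ¬ Leq y (absv P (algebraMap S A s)) := by
  obtain ⟨a, ha, hya⟩ := hP.1.isTotalSemifield.exists_not_leq (exists_residue_ne hP.2.1) hy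
  obtain ⟨s, hs, hsa⟩ := ((mem_contBase_iff hS).1 hP).2.2 a ha
  exact ⟨s, hs, fun h => hya (h.trans hsa)⟩

section Series

variable {S : Subsemiring Trop} {M : Type u} [AddCommMonoid M] {P : RingCon (AddMonoidAlgebra S M)}

/-- The value `|a χ^u|_P` of a term. -/
noncomputable def tabs (P : RingCon (AddMonoidAlgebra S M)) (u : M) (a : S) : ResidueSemifield P :=
  absv P (AddMonoidAlgebra.single u a)

theorem tabs_zero (u : M) : tabs P u 0 = 0 := by
  rw [tabs, AddMonoidAlgebra.single_zero, map_zero]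

theorem tabs_add (u : M) (a b : S) : tabs P u (a + b) = tabs P u a + tabs P u b := by
  rw [tabs, AddMonoidAlgebra.single_add, map_add]
  rfl

theorem tabs_mul (v w : M) (a b : S) : tabs P (v + w) (a * b) = tabs P v a * tabs P w b := by
  rw [tabs, ← AddMonoidAlgebra.single_mul_single, map_mul]
  rfl

theorem tabs_leq (u : M) {a b : S} (h : Leq a b) : Leq (tabs P u a) (tabs P u b) := by
  unfold Leq
  rw [← tabs_add, show a + b = b from h]

theorem algebraMap_eq_single (a : S) :
    algebraMap S (AddMonoidAlgebra S M) a = AddMonoidAlgebra.single 0 a := by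
  rw [AddMonoidAlgebra.coe_algebraMap]
  rfl

theorem absv_algebraMap_eq_tabs (a : S) :
    absv P (algebraMap S (AddMonoidAlgebra S M) a) = tabs P 0 a := by
  rw [algebraMap_eq_single, tabs]

theorem tabs_ne_zero (hP : P ∈ ContBaseInt S (AddMonoidAlgebra S M)) (u : M) {a : S} (ha : a ≠ 0) :
    tabs P u a ≠ 0 := by
  intro h
  rw [tabs, ← map_zero (absv P), absv_eq_iff] at h
  exact ha (AddMonoidAlgebra.single_eq_zero.1 (hP.2 _ h))

variable {hP : P ∈ ContBaseInt S (AddMonoidAlgebra S M)}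

namespace Cnvg

theorem finite_leq (hS : IsSubsemifield S) (f : Cnvg hP) {b : ResidueSemifield P} (hb : b ≠ 0) :
    {u | Leq b (tabs P u (f.1 u))}.Finite := by
  obtain ⟨s, hs, h⟩ := ((mem_contBase_iff hS).1 hP.1).2.2 b hb
  refine (f.2 ((algebraMap S _ s : AddMonoidAlgebra S M) : P.Quotient) ?_).subset fun u hu => ?_
  · intro h0
    rw [quotient_eq_zero_iff, absv_algebraMap_eq_tabs] at h0
    exact tabs_ne_zero hP 0 hs h0
  · exact leq_quotient_iff.2 (h.trans hu)

theorem incl_apply (f : AddMonoidAlgebra S M) (u : M) : (incl hP f).1 u = f.coeff u := rfl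

theorem incl_single_same (u : M) (a : S) :
    (incl hP (AddMonoidAlgebra.single u a)).1 u = a := by
  classical
  rw [incl_apply, AddMonoidAlgebra.coeff_single, Finsupp.single_apply, if_pos rfl]

theorem incl_single_ne {u v : M} (h : u ≠ v) (a : S) :
    (incl hP (AddMonoidAlgebra.single u a)).1 v = 0 := by
  classical
  rw [incl_apply, AddMonoidAlgebra.coeff_single, Finsupp.single_apply, if_neg h]

/-- The ball of radius `r` in terms of coefficients: the maximum in the definition of the distance
exists because the series converge. -/
theorem dist_lt_iff (hS : IsSubsemifield S) (f g : Cnvg hP) {r : ResidueSemifield P}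
    (hr : IsUnit r) : (Leq (dist f g) r ∧ dist f g ≠ r) ↔
      ∀ u, f.1 u ≠ g.1 u → ¬ Leq r (tabs P u (f.1 u + g.1 u)) := by
  have hK := hP.1.1.isTotalSemifield
  rw [hK.leq_and_ne_iff]
  by_cases hD : ∃ u, f.1 u ≠ g.1 u
  · obtain ⟨u₁, hu₁⟩ := hD
    have hne : f.1 u₁ + g.1 u₁ ≠ 0 := by
      intro h0
      apply hu₁
      have h1 := leq_add_left (f.1 u₁) (g.1 u₁)
      have h2 := leq_add_right (f.1 u₁) (g.1 u₁)
      rw [h0] at h1 h2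
      rw [h1.antisymm (leq_zero_left _), h2.antisymm (leq_zero_left _)]
    obtain ⟨u₀, hu₀, hmax⟩ := hK.exists_greatest (s := {u | f.1 u ≠ g.1 u})
      (f := fun u => tabs P u (f.1 u + g.1 u)) hu₁
      (finite_leq hS (f + g) (tabs_ne_zero hP u₁ hne))
    have hd : dist f g = tabs P u₀ (f.1 u₀ + g.1 u₀) := greatest_eq ⟨u₀, hu₀, rfl⟩ (by
      rintro _ ⟨u, hu, rfl⟩
      exact hmax u hu)
    rw [hd]
    exact ⟨fun h u hu h' => h (h'.trans (hmax u hu)), fun h => h u₀ hu₀⟩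
  · push Not at hD
    have hd : dist f g = 0 := dif_neg (by
      rintro ⟨c, ⟨u, hu, -⟩, -⟩
      exact hu (hD u))
    rw [hd]
    exact ⟨fun _ u hu => absurd (hD u) hu,
      fun _ => IsTotalSemifield.not_leq_zero (hK.ne_zero hr)⟩

/-- An open neighbourhood of zero contains all series with sufficiently small terms. -/
theorem exists_ball_of_isOpen (hS : IsSubsemifield S) {U : Set (Cnvg hP)}
    (hU : @IsOpen _ (topology hP) U) (h0 : (0 : Cnvg hP) ∈ U) :
    ∃ r : ResidueSemifield P, r ≠ 0 ∧
      ∀ g : Cnvg hP, (∀ u, ¬ Leq r (tabs P u (g.1 u))) → g ∈ U := by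
  have hK := hP.1.1.isTotalSemifield
  induction hU with
  | basic V hV =>
    obtain ⟨f, r, hr, rfl⟩ := hV
    refine ⟨r, hK.ne_zero hr, fun g hg => (dist_lt_iff hS g f hr).2 fun u _ h => ?_⟩
    rw [tabs_add, hK.leq_add_iff] at h
    rcases h with h | h
    · exact hg u h
    · have hf := (dist_lt_iff hS 0 f hr).1 h0 u
      rw [zero_apply, zero_add] at hf
      refine hf ?_ h
      intro h'
      rw [← h', tabs_zero] at h
      exact IsTotalSemifield.not_leq_zero (hK.ne_zero hr) h
  | univ => exact ⟨1, hK.zero_ne_one.symm, fun _ _ => trivial⟩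
  | inter V W _ _ ihV ihW =>
    obtain ⟨a, ha, hV⟩ := ihV h0.1
    obtain ⟨b, hb, hW⟩ := ihW h0.2
    rcases hK.total a b with h | h
    · exact ⟨a, ha, fun g hg => ⟨hV g hg, hW g fun u h' => hg u (h.trans h')⟩⟩
    · exact ⟨b, hb, fun g hg => ⟨hV g fun u h' => hg u (h.trans h'), hW g hg⟩⟩
  | sUnion F _ ih =>
    obtain ⟨V, hV, h0V⟩ := h0
    obtain ⟨a, ha, h⟩ := ih V hV h0V
    exact ⟨a, ha, fun g hg => ⟨V, hV, h g hg⟩⟩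

/-! ### Continuous primes on the semiring of convergent series -/

variable {Q : RingCon (Cnvg hP)}

/-- Series with small terms have small value at a continuous prime. -/
theorem exists_small_of_mem_contSpec (hS : IsSubsemifield S)
    (hQ : Q ∈ ContSpec (Cnvg hP) (topology hP)) {a : ResidueSemifield Q} (ha : a ≠ 0) :
    ∃ s : S, s ≠ 0 ∧ ∀ g : Cnvg hP, (∀ u, Leq (tabs P u (g.1 u)) (tabs P 0 s)) →
      Leq (absv Q g) a := by
  have hK := hQ.1.isTotalSemifield
  let _ := topology hP
  have hop := ((IsTotalSemifield.continuous_iff _).1 hQ.2.2 a (hK.isUnit a ha)).2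
  obtain ⟨r, hr, h⟩ := exists_ball_of_isOpen hS hop (by
    change Leq (absv Q 0) a
    rw [map_zero]
    exact leq_zero_left a)
  obtain ⟨s, hs, hrs⟩ := exists_base_not_leq hS hP.1 hr
  rw [absv_algebraMap_eq_tabs] at hrs
  exact ⟨s, hs, fun g hg => h g fun u h' => hrs (h'.trans (hg u))⟩

theorem absv_incl_algebraMap_ne_zero (hS : IsSubsemifield S) (hQ : IsPrimeCong Q) {s : S}
    (hs : s ≠ 0) : absv Q (incl hP (algebraMap S _ s)) ≠ 0 :=
  hS.isTotalSemifield.map_ne_zero hQ.isTotalSemifield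
    ((absv Q).comp ((incl hP).comp (algebraMap S _))) hs

theorem absv_incl_algebraMap_leq {a : ResidueSemifield Q} {s : S}
    (h : ∀ g : Cnvg hP, (∀ u, Leq (tabs P u (g.1 u)) (tabs P 0 s)) → Leq (absv Q g) a) :
    Leq (absv Q (incl hP (algebraMap S _ s))) a := by
  rw [algebraMap_eq_single]
  refine h _ fun u => ?_
  by_cases hu : (0 : M) = u
  · subst hu
    rw [incl_single_same]
    exact hP.1.1.isTotalSemifield.leq_refl _
  · rw [incl_single_ne hu, tabs_zero]
    exact leq_zero_left _

/-- Pullback along `ι` maps `Cont (S⟨M⟩_P)` to `Cont_S S[M]`. -/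
theorem comap_mem_contBase (hS : IsSubsemifield S)
    (hQ : Q ∈ ContSpec (Cnvg hP) (topology hP)) :
    Q.comap (incl hP) ∈ ContBase S (AddMonoidAlgebra S M) := by
  have hK := hQ.1.isTotalSemifield
  have hker : ∀ a b, Q.comap (incl hP) a b ↔
      ((absv Q).comp (incl hP)) a = ((absv Q).comp (incl hP)) b := fun a b =>
    (absv_eq_iff (P := Q) (a := incl hP a) (b := incl hP b)).symm
  obtain ⟨j, hj, hjι⟩ := hK.exists_residue_lift hker
  refine (mem_contBase_iff hS).2 ⟨hK.isPrimeCong hker, ?_, fun a ha => ?_⟩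
  · by_contra! hall
    -- Otherwise all units of `S` have value `1` at `Q`, although they become arbitrarily small.
    have hone : ∀ s : S, s ≠ 0 → absv Q (incl hP (algebraMap S _ s)) = 1 := by
      intro s hs
      have h := hall ((algebraMap S _ s : AddMonoidAlgebra S M) : (Q.comap (incl hP)).Quotient)
        fun h0 => by
          have := (hker _ _).1 ((RingCon.eq _).1 h0)
          rw [map_zero] at this
          exact absv_incl_algebraMap_ne_zero hS hQ.1 hs this
      have := (hker _ _).1 ((RingCon.eq _).1 h)
      rw [map_one] at this
      exact this
    obtain ⟨x, hx0, hx1⟩ := exists_residue_ne hQ.2.1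
    refine hx1 (hK.eq_one_of_forall_one_leq (fun a ha => ?_) hx0)
    obtain ⟨s, hs, h⟩ := exists_small_of_mem_contSpec hS hQ ha
    have := absv_incl_algebraMap_leq h
    rwa [hone s hs] at this
  · obtain ⟨s, hs, h⟩ := exists_small_of_mem_contSpec hS hQ (a := j a)
      fun h => ha (hj (by rw [h, map_zero]))
    refine ⟨s, hs, (leq_map_iff hj).1 ?_⟩
    rw [hjι]
    exact absv_incl_algebraMap_leq h

/-- The part of a series supported on a set of exponents. -/
noncomputable def restrict (f : Cnvg hP) (p : Set M) : Cnvg hP := by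
  classical
  exact ⟨fun u => if u ∈ p then f.1 u else 0, fun b hb => (f.2 b hb).subset fun u hu => by
    by_cases h : u ∈ p
    · simpa only [Set.mem_ofPred_eq, if_pos h] using hu
    · simp only [Set.mem_ofPred_eq, if_neg h] at hu
      exact absurd hu (q_not_leq_zero (b := b) hb ∘ fun h => by
        rwa [AddMonoidAlgebra.single_zero] at h)⟩

theorem restrict_of_mem (f : Cnvg hP) {p : Set M} {u : M} (h : u ∈ p) :
    (restrict f p).1 u = f.1 u := if_pos h

theorem restrict_of_notMem (f : Cnvg hP) {p : Set M} {u : M} (h : u ∉ p) :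
    (restrict f p).1 u = 0 := if_neg h

theorem restrict_add_restrict_compl (f : Cnvg hP) (p : Set M) :
    restrict f p + restrict f pᶜ = f := by
  refine ext fun u => ?_
  rw [add_apply]
  by_cases h : u ∈ p
  · rw [restrict_of_mem f h, restrict_of_notMem f (Set.notMem_compl_iff.2 h), add_zero]
  · rw [restrict_of_notMem f h, restrict_of_mem f h, zero_add]

theorem sum_apply {ι : Type*} (F : Finset ι) (f : ι → Cnvg hP) (u : M) :
    (∑ i ∈ F, f i).1 u = ∑ i ∈ F, (f i).1 u := by
  classical
  induction F using Finset.induction_on with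
  | empty => rfl
  | insert a F ha ih => rw [Finset.sum_insert ha, Finset.sum_insert ha, add_apply, ih]

theorem restrict_finset (f : Cnvg hP) (F : Finset M) :
    restrict f (F : Set M) = ∑ v ∈ F, incl hP (AddMonoidAlgebra.single v (f.1 v)) := by
  classical
  refine ext fun u => ?_
  rw [sum_apply]
  by_cases h : u ∈ F
  · rw [restrict_of_mem f (Finset.mem_coe.2 h), Finset.sum_eq_single_of_mem u h, incl_single_same]
    intro v _ hv
    exact incl_single_ne hv _
  · rw [restrict_of_notMem f (fun h' => h (Finset.mem_coe.1 h')), Finset.sum_eq_zero]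
    intro v hv
    refine incl_single_ne ?_ _
    rintro rfl
    exact h hv

theorem absv_term_leq (f : Cnvg hP) (u : M) :
    Leq (absv Q (incl hP (AddMonoidAlgebra.single u (f.1 u)))) (absv Q f) := by
  refine Leq.map _ (ext fun v => ?_)
  rw [add_apply]
  by_cases h : u = v
  · subst h
    rw [incl_single_same]
    exact leq_refl _
  · rw [incl_single_ne h, zero_add]

/-- The value of a series at a continuous prime is attained by one of its terms: the tail of the
series is negligible. -/
theorem exists_absv_leq_term (hS : IsSubsemifield S)
    (hQ : Q ∈ ContSpec (Cnvg hP) (topology hP)) (f : Cnvg hP) :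
    ∃ v, Leq (absv Q f) (absv Q (incl hP (AddMonoidAlgebra.single v (f.1 v)))) := by
  have hK := hQ.1.isTotalSemifield
  by_cases hf : absv Q f = 0
  · rw [hf]
    exact ⟨0, leq_zero_left _⟩
  obtain ⟨a, ha, hfa⟩ := hK.exists_not_leq (exists_residue_ne hQ.2.1) hf
  obtain ⟨s, hs, hsmall⟩ := exists_small_of_mem_contSpec hS hQ ha
  have hfin := finite_leq hS f (tabs_ne_zero hP 0 hs)
  have htail : Leq (absv Q (restrict f (hfin.toFinset : Set M)ᶜ)) a := by
    refine hsmall _ fun u => ?_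
    by_cases hu : u ∈ (hfin.toFinset : Set M)ᶜ
    · rw [restrict_of_mem f hu]
      refine (hP.1.1.isTotalSemifield.total _ _).resolve_right fun h => hu ?_
      exact Finset.mem_coe.2 (hfin.mem_toFinset.2 h)
    · rw [restrict_of_notMem f hu, tabs_zero]
      exact leq_zero_left _
  have hsum : Leq (absv Q f) (absv Q f) := hK.leq_refl _
  nth_rewrite 2 [← restrict_add_restrict_compl f (hfin.toFinset : Set M)] at hsum
  rw [map_add, hK.leq_add_iff, restrict_finset, map_sum] at hsum
  rcases hsum with h | h
  · obtain ⟨v, -, hv⟩ := hK.exists_leq_of_leq_sum hf h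
    exact ⟨v, hv⟩
  · exact absurd (h.trans htail) hfa

/-- A continuous prime on the semiring of convergent series is determined by its restriction to
polynomials, which tells how the terms of two series compare. -/
theorem rel_iff_comap (hS : IsSubsemifield S) (hQ : Q ∈ ContSpec (Cnvg hP) (topology hP))
    (f g : Cnvg hP) : Q f g ↔
      (∀ u, ∃ v, Q.comap (incl hP) (AddMonoidAlgebra.single u (f.1 u) +
        AddMonoidAlgebra.single v (g.1 v)) (AddMonoidAlgebra.single v (g.1 v))) ∧
      (∀ u, ∃ v, Q.comap (incl hP) (AddMonoidAlgebra.single u (g.1 u) +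
        AddMonoidAlgebra.single v (f.1 v)) (AddMonoidAlgebra.single v (f.1 v))) := by
  have key : ∀ f g : Cnvg hP, Leq (absv Q f) (absv Q g) ↔
      ∀ u, ∃ v, Q.comap (incl hP) (AddMonoidAlgebra.single u (f.1 u) +
        AddMonoidAlgebra.single v (g.1 v)) (AddMonoidAlgebra.single v (g.1 v)) := by
    intro f g
    have hrel : ∀ x y, Q.comap (incl hP) (x + y) y ↔
        Leq (absv Q (incl hP x)) (absv Q (incl hP y)) := by
      intro x y
      rw [absv_leq_iff, ← map_add]
      rfl
    simp only [hrel]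
    constructor
    · intro h u
      obtain ⟨v, hv⟩ := exists_absv_leq_term hS hQ g
      exact ⟨v, ((absv_term_leq f u).trans h).trans hv⟩
    · intro h
      obtain ⟨u, hu⟩ := exists_absv_leq_term hS hQ f
      obtain ⟨v, hv⟩ := h u
      exact (hu.trans hv).trans (absv_term_leq g v)
  rw [← key, ← key, ← absv_eq_iff]
  refine ⟨fun h => ?_, fun h => h.1.antisymm h.2⟩
  rw [h]
  exact ⟨hQ.1.isTotalSemifield.leq_refl _, hQ.1.isTotalSemifield.leq_refl _⟩

theorem comap_injOn (hS : IsSubsemifield S) :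
    Set.InjOn (fun Q : RingCon (Cnvg hP) => Q.comap (incl hP))
      (ContSpec (Cnvg hP) (topology hP)) := by
  intro Q hQ Q' hQ' h
  refine RingCon.ext fun f g => ?_
  have h' : Q.comap (incl hP) = Q'.comap (incl hP) := h
  rw [rel_iff_comap hS hQ, rel_iff_comap hS hQ', h']

end Cnvg

end Series

/-! ### The image of the pullback -/

section Series

variable {S : Subsemiring Trop} {M : Type u} [AddCommMonoid M] {P : RingCon (AddMonoidAlgebra S M)}
  {P' : RingCon (AddMonoidAlgebra S M)} {φ ψ : AddMonoidAlgebra S M →+* Trop}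
  {hP : P ∈ ContBaseInt S (AddMonoidAlgebra S M)}

namespace Cnvg

/-- If `P'` is the restriction of a continuous prime, then its tropicalization is dominated by that
of `P`: otherwise suitably scaled powers of a monomial would converge to zero at `P`, but stay
bounded away from zero at `P'`. -/
theorem single_le_of_mem_image (hS : IsSubsemifield S) (hφ : IsTropicalization (S := S) P φ)
    (hψ : IsTropicalization (S := S) P' ψ)
    (h : P' ∈ (fun Q : RingCon (Cnvg hP) => Q.comap (incl hP)) ''
      ContSpec (Cnvg hP) (topology hP)) (u : M) :
    ψ (AddMonoidAlgebra.single u 1) ≤ φ (AddMonoidAlgebra.single u 1) := by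
  obtain ⟨Q, hQ, rfl⟩ := h
  have hone : (1 : S) ≠ 0 := hS.isTotalSemifield.zero_ne_one.symm
  by_contra! hlt
  obtain ⟨x, hx⟩ := MaxPlus.exists_t (hφ.ne_zero hS hP.1 (tabs_ne_zero hP u hone))
  obtain ⟨y, hy⟩ := MaxPlus.exists_t (x := ψ (AddMonoidAlgebra.single u 1)) fun h0 => by
    rw [h0] at hlt
    exact hlt.not_ge (MaxPlus.zero_le' _)
  have hxy : x < y := by rwa [hx, hy, MaxPlus.t_lt_t] at hlt
  obtain ⟨s₀, r₀, hr₀, hs₀⟩ := hS.exists_pos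
  obtain ⟨s₁, -, hs₁⟩ := hS.exists_inv hs₀
  obtain ⟨s, hs, hsmall⟩ := exists_small_of_mem_contSpec hS hQ
    (absv_incl_algebraMap_ne_zero hS hQ.1 (ne_zero_of_coe_eq_t hs₁))
  obtain ⟨r, hr⟩ := exists_coe_eq_t hs
  obtain ⟨n, hn⟩ := exists_nat_gt ((r₀ - r) / (y - x))
  rw [div_lt_iff₀ (by linarith)] at hn
  -- `t ^ (k r₀)` scales the `n`-th power of `χ ^ u` to have value in `[1, t ^ r₀)` at `P'`.
  let k : ℤ := ⌈-(n * y) / r₀⌉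
  have hk1 : -(n * y) ≤ k * r₀ := by
    rw [← div_le_iff₀ hr₀]
    exact Int.le_ceil _
  have hk2 : k * r₀ < -(n * y) + r₀ := by
    have := Int.ceil_lt_add_one (-(n * y) / r₀)
    have := mul_lt_mul_of_pos_right this hr₀
    rwa [add_mul, div_mul_cancel₀ _ hr₀.ne', one_mul] at this
  obtain ⟨sn, hsn⟩ := hS.exists_zpow hs₀ k
  have hpow : (AddMonoidAlgebra.single (n • u) sn : AddMonoidAlgebra S M) =
      algebraMap S _ sn * AddMonoidAlgebra.single u 1 ^ n := by
    rw [AddMonoidAlgebra.single_pow, one_pow, ← single_eq_algebraMap_mul]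
  have hφm : φ (AddMonoidAlgebra.single (n • u) sn) = MaxPlus.t (k * r₀ + n * x) := by
    rw [hpow, map_mul, map_pow, hφ.base, hsn, hx, MaxPlus.t_pow, ← MaxPlus.t_add, nsmul_eq_mul]
  have hψm : ψ (AddMonoidAlgebra.single (n • u) sn) = MaxPlus.t (k * r₀ + n * y) := by
    rw [hpow, map_mul, map_pow, hψ.base, hsn, hy, MaxPlus.t_pow, ← MaxPlus.t_add, nsmul_eq_mul]
  have hle : Leq (tabs P (n • u) sn) (tabs P 0 s) := by
    rw [← absv_algebraMap_eq_tabs]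
    refine hφ.leq_of_lt hP.1.1 ?_
    rw [hφm, hφ.base, hr, MaxPlus.t_lt_t]
    linarith
  have hQle := hsmall (incl hP (AddMonoidAlgebra.single (n • u) sn)) fun v => by
    by_cases hv : n • u = v
    · subst hv
      rwa [incl_single_same]
    · rw [incl_single_ne hv, tabs_zero]
      exact leq_zero_left _
  rw [absv_leq_iff, ← map_add] at hQle
  have := hψ.le_of_leq (absv_leq_iff.2 hQle)
  rw [hψm, hψ.base, hs₁, MaxPlus.t_le_t] at this
  linarith

/-- If the tropicalization of `P'` is dominated by that of `P`, then terms that are small at `P`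
are small at `P'`. -/
theorem exists_tabs_leq_of_tabs_leq (hS : IsSubsemifield S)
    (hP : P ∈ ContBaseInt S (AddMonoidAlgebra S M))
    (hP' : P' ∈ ContBase S (AddMonoidAlgebra S M)) (hφ : IsTropicalization (S := S) P φ)
    (hψ : IsTropicalization (S := S) P' ψ)
    (h : ∀ u : M, ψ (AddMonoidAlgebra.single u 1) ≤ φ (AddMonoidAlgebra.single u 1))
    {b : ResidueSemifield P'} (hb : b ≠ 0) :
    ∃ r : ResidueSemifield P, r ≠ 0 ∧ ∀ u a, Leq b (tabs P' u a) → Leq r (tabs P u a) := by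
  obtain ⟨s, hs, hsb⟩ := ((mem_contBase_iff hS).1 hP').2.2 b hb
  obtain ⟨x, hx⟩ := exists_coe_eq_t hs
  obtain ⟨s', x', hs', hx'⟩ := hS.exists_lt x
  refine ⟨tabs P 0 s', tabs_ne_zero hP 0 (ne_zero_of_coe_eq_t hs'), fun u a hle => ?_⟩
  rw [← absv_algebraMap_eq_tabs]
  refine hφ.leq_of_lt hP.1.1 ?_
  refine lt_of_lt_of_le ?_ ((hψ.le_of_leq (hsb.trans hle)).trans (hφ.single_le hψ h u a))
  rw [hφ.base, hψ.base, hx, hs', MaxPlus.t_lt_t]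
  exact hx'

theorem finite_leq_of_dominated (hS : IsSubsemifield S)
    (hP' : P' ∈ ContBase S (AddMonoidAlgebra S M)) (hφ : IsTropicalization (S := S) P φ)
    (hψ : IsTropicalization (S := S) P' ψ)
    (h : ∀ u : M, ψ (AddMonoidAlgebra.single u 1) ≤ φ (AddMonoidAlgebra.single u 1))
    (f : Cnvg hP) {b : ResidueSemifield P'} (hb : b ≠ 0) :
    {u | Leq b (tabs P' u (f.1 u))}.Finite := by
  obtain ⟨r, hr, hle⟩ := exists_tabs_leq_of_tabs_leq hS hP hP' hφ hψ h hb
  exact (finite_leq hS f hr).subset fun u hu => hle _ _ hu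

/-- If the tropicalization of `P'` is dominated by that of `P`, the greatest value of a term at `P'`
defines an extension of `|·|_{P'}` to the convergent series. -/
theorem exists_extension (hS : IsSubsemifield S)
    (hP' : P' ∈ ContBase S (AddMonoidAlgebra S M)) (hφ : IsTropicalization (S := S) P φ)
    (hψ : IsTropicalization (S := S) P' ψ)
    (h : ∀ u : M, ψ (AddMonoidAlgebra.single u 1) ≤ φ (AddMonoidAlgebra.single u 1)) :
    ∃ N : Cnvg hP →+* ResidueSemifield P',
    (∀ f, ∃ u, N f = tabs P' u (f.1 u)) ∧ (∀ f u, Leq (tabs P' u (f.1 u)) (N f)) ∧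
      ∀ x, N (incl hP x) = absv P' x := by
  have hK := hP'.1.isTotalSemifield
  let N : Cnvg hP → ResidueSemifield P' := fun f => greatest (Set.range fun u => tabs P' u (f.1 u))
  have hN : ∀ (f : Cnvg hP) (c : ResidueSemifield P'), (∃ u, c = tabs P' u (f.1 u)) →
      (∀ u, Leq (tabs P' u (f.1 u)) c) → N f = c := by
    rintro f c ⟨u, rfl⟩ hle
    refine greatest_eq ⟨u, rfl⟩ ?_
    rintro _ ⟨v, rfl⟩
    exact hle v
  have hspec : ∀ f : Cnvg hP, (∃ u, N f = tabs P' u (f.1 u)) ∧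
      ∀ u, Leq (tabs P' u (f.1 u)) (N f) := by
    intro f
    obtain ⟨u, hu⟩ : ∃ u, ∀ v, Leq (tabs P' v (f.1 v)) (tabs P' u (f.1 u)) := by
      by_cases hz : ∀ u, tabs P' u (f.1 u) = 0
      · refine ⟨0, fun v => ?_⟩
        rw [hz v]
        exact leq_zero_left _
      · push Not at hz
        obtain ⟨u, hu⟩ := hz
        obtain ⟨v, -, hv⟩ := hK.exists_greatest (Set.mem_univ u)
          (f := fun u => tabs P' u (f.1 u)) (finite_leq_of_dominated hS hP' hφ hψ h f hu)
        exact ⟨v, fun w => hv w (Set.mem_univ w)⟩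
    have := hN f _ ⟨u, rfl⟩ hu
    rw [this]
    exact ⟨⟨u, rfl⟩, hu⟩
  have hsingle : ∀ u a, N (incl hP (AddMonoidAlgebra.single u a)) = tabs P' u a := by
    intro u a
    refine hN _ _ ⟨u, by rw [incl_single_same]⟩ fun v => ?_
    by_cases hv : u = v
    · subst hv
      rw [incl_single_same]
      exact hK.leq_refl _
    · rw [incl_single_ne hv, tabs_zero]
      exact leq_zero_left _
  have hadd : ∀ f g, N (f + g) = N f + N g := by
    have key : ∀ f g, Leq (N f) (N g) → N (f + g) = N g := by
      intro f g hle
      obtain ⟨v, hv⟩ := (hspec g).1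
      refine hN _ _ ⟨v, ?_⟩ fun u => ?_
      · rw [add_apply, tabs_add, hv]
        have := ((hspec f).2 v).trans hle
        rw [hv] at this
        exact this.symm
      · rw [add_apply, tabs_add]
        exact (((hspec f).2 u).trans hle).add ((hspec g).2 u)
    intro f g
    rcases hK.total (N f) (N g) with hle | hle
    · rw [key f g hle]
      exact hle.symm
    · rw [add_comm f, key g f hle, add_comm]
      exact hle.symm
  let N' : Cnvg hP →+* ResidueSemifield P' :=
    { toFun := N
      map_one' := by
        have := hsingle 0 1
        rwa [← AddMonoidAlgebra.one_def, map_one, tabs, ← AddMonoidAlgebra.one_def, map_one] at this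
      map_zero' := hN _ _ ⟨0, by rw [zero_apply, tabs_zero]⟩ fun u => by
        rw [zero_apply, tabs_zero]
        exact leq_zero_left _
      map_add' := hadd
      map_mul' := fun f g => by
        have hle : ∀ u, Leq (tabs P' u ((f * g).1 u)) (N f * N g) := by
          intro u
          obtain ⟨v, w, rfl, e⟩ := (mul_spec f g u).1
          rw [e, tabs_mul]
          exact ((hspec f).2 v).mul ((hspec g).2 w)
        obtain ⟨v, hv⟩ := (hspec f).1
        obtain ⟨w, hw⟩ := (hspec g).1
        refine hN _ _ ⟨v + w, (Leq.antisymm ?_ (hle _))⟩ hle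
        rw [hv, hw, ← tabs_mul]
        exact tabs_leq _ ((mul_spec f g (v + w)).2 v w rfl) }
  refine ⟨N', fun f => (hspec f).1, fun f => (hspec f).2, fun x => ?_⟩
  have : (N' : Cnvg hP →+ ResidueSemifield P').comp (incl hP : AddMonoidAlgebra S M →+ Cnvg hP) =
      (absv P' : AddMonoidAlgebra S M →+ ResidueSemifield P') :=
    AddMonoidAlgebra.addMonoidHom_ext fun u a => hsingle u a
  exact DFunLike.congr_fun this x

/-- If the tropicalization of `P'` is dominated by that of `P`, then `P'` is the restriction of a
continuous prime on the convergent series. -/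
theorem mem_image_of_single_le (hS : IsSubsemifield S)
    (hP' : P' ∈ ContBase S (AddMonoidAlgebra S M)) (hφ : IsTropicalization (S := S) P φ)
    (hψ : IsTropicalization (S := S) P' ψ)
    (h : ∀ u : M, ψ (AddMonoidAlgebra.single u 1) ≤ φ (AddMonoidAlgebra.single u 1)) :
    P' ∈ (fun Q : RingCon (Cnvg hP) => Q.comap (incl hP)) ''
    ContSpec (Cnvg hP) (topology hP) := by
  have hK := hP'.1.isTotalSemifield
  obtain ⟨N, hatt, hle, hι⟩ := exists_extension (hP := hP) hS hP' hφ hψ h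
  have hker : ∀ f g, RingCon.ker N f g ↔ N f = N g := fun f g => RingCon.ker_apply N
  obtain ⟨j, hj, hjN⟩ := hK.exists_residue_lift hker
  have hcomap : (RingCon.ker N).comap (incl hP) = P' := by
    refine RingCon.ext fun x y => ?_
    rw [← absv_eq_iff (P := P'), ← hι, ← hι]
    exact hker _ _
  refine ⟨RingCon.ker N, ⟨hK.isPrimeCong hker, ?_, ?_⟩, hcomap⟩
  · obtain ⟨x, hx0, hx1⟩ := hP'.2.1
    obtain ⟨a, rfl⟩ := P'.mk'_surjective x
    refine ⟨((incl hP a : Cnvg hP) : (RingCon.ker N).Quotient), fun h0 => hx0 ?_, fun h1 => hx1 ?_⟩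
    · have := (hker _ _).1 ((RingCon.eq _).1 h0)
      rw [hι, map_zero] at this
      exact quotient_eq_zero_iff.2 this
    · have := (hker _ _).1 ((RingCon.eq _).1 h1)
      rw [hι, map_one, ← map_one (absv P'), absv_eq_iff] at this
      exact (RingCon.eq _).2 this
  · -- Values that are not too small are locally constant.
    have hball : ∀ b : ResidueSemifield P', b ≠ 0 → ∃ r : ResidueSemifield P, IsUnit r ∧
        ∀ f g : Cnvg hP, (Leq (dist g f) r ∧ dist g f ≠ r) →
          ∀ y, Leq b y → (Leq y (N g) ↔ Leq y (N f)) := by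
      intro b hb
      obtain ⟨r, hr, hrb⟩ := exists_tabs_leq_of_tabs_leq hS hP hP' hφ hψ h hb
      have hru := hP.1.1.isTotalSemifield.isUnit r hr
      refine ⟨r, hru, fun f g hd y hy => ?_⟩
      rw [dist_lt_iff hS g f hru] at hd
      have hd' : ∀ u, Leq y (tabs P' u (g.1 u)) ∨ Leq y (tabs P' u (f.1 u)) →
          g.1 u = f.1 u := by
        intro u hu
        by_contra hne
        refine hd u hne (hrb _ _ ?_)
        rw [tabs_add, hK.leq_add_iff]
        exact hu.imp hy.trans hy.trans
      constructor
      · intro hyg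
        obtain ⟨v, hv⟩ := hatt g
        rw [hv] at hyg
        rw [hd' v (Or.inl hyg)] at hyg
        exact hyg.trans (hle f v)
      · intro hyf
        obtain ⟨v, hv⟩ := hatt f
        rw [hv] at hyf
        rw [← hd' v (Or.inr hyf)] at hyf
        exact hyf.trans (hle g v)
    have hself : ∀ (f : Cnvg hP) (r : ResidueSemifield P), IsUnit r →
        Leq (dist f f) r ∧ dist f f ≠ r := fun f r hr =>
      (dist_lt_iff hS f f hr).2 fun u hu => absurd rfl hu
    let _ := topology hP
    refine (IsTotalSemifield.continuous_iff _).2 fun a ha => ?_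
    have hb : j a ≠ 0 := fun h0 =>
      (hK.isPrimeCong hker).isTotalSemifield.ne_zero ha (hj (by rw [h0, map_zero]))
    obtain ⟨r, hr, hloc⟩ := hball (j a) hb
    have hopen : ∀ f : Cnvg hP, IsOpen {g | Leq (dist g f) r ∧ dist g f ≠ r} := fun f =>
      TopologicalSpace.isOpen_generateFrom_of_mem ⟨f, r, hr, rfl⟩
    have hleq : ∀ f g : Cnvg hP, (Leq (dist g f) r ∧ dist g f ≠ r) → Leq (N f) (j a) →
        Leq (N g) (j a) := by
      intro f g hd hf
      rcases hK.total (N g) (j a) with hg | hg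
      · exact hg
      · exact ((hloc f g hd _ hg).1 (hK.leq_refl _)).trans hf
    constructor
    · refine isOpen_iff_forall_mem_open.2 fun f hf => ⟨_, fun g hd => ?_, hopen f, hself f r hr⟩
      have hf' : N f = j a := by rw [← hjN, show absv (RingCon.ker N) f = a from hf]
      refine hj ?_
      rw [hjN]
      refine (hleq f g hd (by rw [hf']; exact hK.leq_refl _)).antisymm ?_
      rw [hloc f g hd _ (hK.leq_refl _), hf']
      exact hK.leq_refl _
    · refine isOpen_iff_forall_mem_open.2 fun f hf => ⟨_, fun g hd => ?_, hopen f, hself f r hr⟩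
      have hf' : Leq (absv (RingCon.ker N) f) a := hf
      change Leq (absv (RingCon.ker N) g) a
      rw [← leq_map_iff hj, hjN] at hf' ⊢
      exact hleq f g hd hf'

end Cnvg

end Series

/-! ### The closure of a cone in the tropical toric variety -/

/-- A real-valued homomorphism on a submonoid of an abelian group extends to the whole group. -/
theorem AddSubmonoid.exists_extension {Λ : Type*} [AddCommGroup Λ] (F : AddSubmonoid Λ)
    (ℓ : F →+ ℝ) : ∃ v : Λ →+ ℝ, ∀ u : F, v u = ℓ u := by
  have hof : ∀ {G : Type _} [AddCommGroup G] (f : F →+ G) (u : F),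
      Algebra.GrothendieckAddGroup.lift f (Algebra.GrothendieckAddGroup.of u) = f u :=
    fun f u => DFunLike.congr_fun (Algebra.GrothendieckAddGroup.lift.symm_apply_apply f) u
  have hsurj : ∀ x : Algebra.GrothendieckAddGroup F, ∃ a b : F,
      x + Algebra.GrothendieckAddGroup.of b = Algebra.GrothendieckAddGroup.of a := by
    intro x
    obtain ⟨⟨a, b⟩, h⟩ := (AddLocalization.addMonoidOf (⊤ : AddSubmonoid F)).surj x
    exact ⟨a, b, h⟩
  have hinj : Function.Injective (Algebra.GrothendieckAddGroup.lift F.subtype) := by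
    rw [injective_iff_map_eq_zero]
    intro x hx
    obtain ⟨a, b, h⟩ := hsurj x
    have := congrArg (Algebra.GrothendieckAddGroup.lift F.subtype) h
    rw [map_add, hx, zero_add, hof, hof] at this
    rw [Subtype.ext this] at h
    exact add_eq_right.1 h
  obtain ⟨v, hv⟩ := (Module.Baer.of_divisible ℝ).extension_property_addMonoidHom
    (Algebra.GrothendieckAddGroup.lift F.subtype) hinj (Algebra.GrothendieckAddGroup.lift ℓ)
  refine ⟨v, fun u => ?_⟩
  have := DFunLike.congr_fun hv (Algebra.GrothendieckAddGroup.of u)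
  rw [AddMonoidHom.comp_apply, hof] at this
  exact this.trans (DFunLike.congr_fun (Algebra.GrothendieckAddGroup.lift.symm_apply_apply ℓ) u)

/-- Fourier–Motzkin elimination: the dual of a rational polyhedral cone is cut out by finitely many
lattice points. -/
theorem exists_dual_generators {Λ : Type*} [AddCommGroup Λ] [Module.Finite ℤ Λ]
    (F : Finset (Λ →+ ℤ)) : ∃ U : Finset Λ, (∀ u ∈ U, ∀ s ∈ F, s u ≤ 0) ∧
      ∀ v : Λ →+ ℝ, (∀ u ∈ U, v u ≤ 0) → v ∈ Submodule.span NNReal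
        ((fun s : Λ →+ ℤ => (Int.castAddHom ℝ).comp s) '' (F : Set (Λ →+ ℤ))) := by
  classical
  induction F using Finset.induction_on with
  | empty =>
    obtain ⟨B, hB⟩ := (Module.Finite.fg_top : (⊤ : Submodule ℤ Λ).FG)
    refine ⟨B ∪ B.image (fun u => -u), fun u _ s hs => absurd hs (Finset.notMem_empty s),
      fun v hv => ?_⟩
    have hv0 : v = 0 := by
      have : v.toIntLinearMap = 0 := by
        refine LinearMap.ext_on hB fun u hu => ?_
        have h1 := hv u (Finset.mem_union_left _ hu)
        have h2 := hv (-u) (Finset.mem_union_right _ (Finset.mem_image_of_mem _ hu))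
        rw [map_neg] at h2
        change v u = 0
        linarith
      exact AddMonoidHom.ext fun u => LinearMap.congr_fun this u
    rw [hv0]
    exact Submodule.zero_mem _
  | insert s F hs ih =>
    obtain ⟨U, hU, hdual⟩ := ih
    let U' : Finset Λ := U.filter (fun u => s u ≤ 0) ∪
      ((U.filter fun u => 0 < s u) ×ˢ (U.filter fun u => s u < 0)).image
        fun p => (-(s p.2)) • p.1 + s p.1 • p.2
    have hmix : ∀ u ∈ U, ∀ u' ∈ U, 0 < s u → s u' < 0 → (-(s u')) • u + s u • u' ∈ U' := by
      intro u hu u' hu' h h'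
      refine Finset.mem_union_right _ (Finset.mem_image.2 ⟨(u, u'), ?_, rfl⟩)
      exact Finset.mem_product.2 ⟨Finset.mem_filter.2 ⟨hu, h⟩, Finset.mem_filter.2 ⟨hu', h'⟩⟩
    refine ⟨U', fun u hu s' hs' => ?_, fun v hv => ?_⟩
    · rcases Finset.mem_union.1 hu with h | h
      · obtain ⟨h1, h2⟩ := Finset.mem_filter.1 h
        rcases Finset.mem_insert.1 hs' with rfl | hs'
        exacts [h2, hU u h1 s' hs']
      · obtain ⟨⟨x, y⟩, hp, rfl⟩ := Finset.mem_image.1 h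
        obtain ⟨hx, hy⟩ := Finset.mem_product.1 hp
        obtain ⟨hx, hx'⟩ := Finset.mem_filter.1 hx
        obtain ⟨hy, hy'⟩ := Finset.mem_filter.1 hy
        simp only at hx hx' hy hy' ⊢
        rw [map_add, map_zsmul, map_zsmul, smul_eq_mul, smul_eq_mul]
        rcases Finset.mem_insert.1 hs' with rfl | hs'
        · linarith [mul_comm (s' x) (s' y)]
        · have h1 := mul_nonpos_of_nonneg_of_nonpos (by linarith : 0 ≤ -(s y)) (hU x hx s' hs')
          have h2 := mul_nonpos_of_nonneg_of_nonpos hx'.le (hU y hy s' hs')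
          linarith
    · -- The multiple `c` of `s` to be split off: the least one allowed by the positive side.
      obtain ⟨c, hc, hcU, hcatt⟩ : ∃ c : ℝ, 0 ≤ c ∧ (∀ u ∈ U, 0 < s u → v u ≤ c * s u) ∧
          (c = 0 ∨ ∃ u ∈ U, 0 < s u ∧ v u = c * s u) := by
        by_cases hex : ∃ u ∈ U, 0 < s u ∧ 0 < v u
        · obtain ⟨u₁, hu₁, hs₁, hv₁⟩ := hex
          obtain ⟨u₀, hu₀, hmax⟩ := (U.filter fun u => 0 < s u).exists_max_image
            (fun u => v u / s u) ⟨u₁, Finset.mem_filter.2 ⟨hu₁, hs₁⟩⟩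
          obtain ⟨hu₀, hs₀⟩ := Finset.mem_filter.1 hu₀
          have hs₀' : (0 : ℝ) < s u₀ := Int.cast_pos.2 hs₀
          refine ⟨v u₀ / s u₀, ?_, fun u hu hsu => ?_,
            Or.inr ⟨u₀, hu₀, hs₀, (div_mul_cancel₀ _ hs₀'.ne').symm⟩⟩
          · exact (div_pos hv₁ (Int.cast_pos.2 hs₁)).le.trans
              (hmax u₁ (Finset.mem_filter.2 ⟨hu₁, hs₁⟩))
          · rw [← div_le_iff₀ (Int.cast_pos.2 hsu)]
            exact hmax u (Finset.mem_filter.2 ⟨hu, hsu⟩)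
        · push Not at hex
          exact ⟨0, le_rfl, fun u hu hsu => by rw [zero_mul]; exact hex u hu hsu, Or.inl rfl⟩
      let r : NNReal := ⟨c, hc⟩
      let s' : Λ →+ ℝ := (Int.castAddHom ℝ).comp s
      have hr : ∀ u, (r • s') u = c * s u := fun u => rfl
      have hrest : v - r • s' ∈ Submodule.span NNReal
          ((fun s : Λ →+ ℤ => (Int.castAddHom ℝ).comp s) '' (F : Set (Λ →+ ℤ))) := by
        refine hdual _ fun u hu => ?_
        rw [AddMonoidHom.sub_apply, hr, sub_nonpos]
        rcases lt_trichotomy (s u) 0 with h | h | h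
        · have hvu := hv u (Finset.mem_union_left _ (Finset.mem_filter.2 ⟨hu, h.le⟩))
          rcases hcatt with rfl | ⟨u₀, hu₀, hs₀, hv₀⟩
          · rwa [zero_mul]
          · have hs₀' : (0 : ℝ) < s u₀ := Int.cast_pos.2 hs₀
            have := hv _ (hmix u₀ hu₀ u hu hs₀ h)
            rw [map_add, map_zsmul, map_zsmul, zsmul_eq_mul, zsmul_eq_mul, hv₀,
              Int.cast_neg] at this
            refine le_of_mul_le_mul_left ?_ hs₀'
            linarith
        · rw [h, Int.cast_zero, mul_zero]
          exact hv u (Finset.mem_union_left _ (Finset.mem_filter.2 ⟨hu, h.le⟩))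
        · exact hcU u hu h
      have hmem : r • s' ∈ Submodule.span NNReal
          ((fun s : Λ →+ ℤ => (Int.castAddHom ℝ).comp s) ''
            ((insert s F : Finset (Λ →+ ℤ)) : Set (Λ →+ ℤ))) :=
        Submodule.smul_mem _ _ (Submodule.subset_span
          ⟨s, Finset.mem_coe.2 (Finset.mem_insert_self s F), rfl⟩)
      have hle := Submodule.span_mono (R := NNReal)
        (Set.image_mono (f := fun s : Λ →+ ℤ => (Int.castAddHom ℝ).comp s)
          (Finset.coe_subset.2 (Finset.subset_insert s F)))
      have := Submodule.add_mem _ (hle hrest) hmem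
      rwa [sub_add_cancel] at this

section Toric

variable {Λ : Type u} [AddCommGroup Λ] {σ : PointedCone ℝ (Λ →+ ℝ)}

theorem mem_toricMonoid_iff {F : Finset (Λ →+ ℤ)}
    (hF : σ = Submodule.span NNReal
      ((fun v : Λ →+ ℤ => (Int.castAddHom ℝ).comp v) '' (F : Set (Λ →+ ℤ)))) {u : Λ} :
    u ∈ toricMonoid σ ↔ ∀ s ∈ F, s u ≤ 0 := by
  constructor
  · intro hu s hs
    have hmem : (Int.castAddHom ℝ).comp s ∈ σ := by
      rw [hF]
      exact Submodule.subset_span ⟨s, Finset.mem_coe.2 hs, rfl⟩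
    exact Int.cast_nonpos.1 (hu _ hmem)
  · intro hu v hv
    rw [hF] at hv
    induction hv using Submodule.span_induction with
    | mem v hv =>
      obtain ⟨s, hs, rfl⟩ := hv
      exact Int.cast_nonpos.2 (hu s (Finset.mem_coe.1 hs))
    | zero => exact le_rfl
    | add v w _ _ hv hw => exact add_nonpos hv hw
    | smul r v _ hv => exact mul_nonpos_of_nonneg_of_nonpos r.2 hv

theorem tropExp_t (r : ℝ) : tropExp (MaxPlus.t r) = Real.exp r := rfl

theorem tropExp_zero : tropExp 0 = 0 := rfl

theorem tropExp_le_one {x : Trop} : tropExp x ≤ 1 ↔ x ≤ 1 := by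
  by_cases hx : x = 0
  · subst hx
    exact ⟨fun _ => MaxPlus.zero_le' _, fun _ => by rw [tropExp_zero]; exact zero_le_one⟩
  · obtain ⟨r, rfl⟩ := MaxPlus.exists_t hx
    rw [tropExp_t, Real.exp_le_one_iff, ← MaxPlus.t_zero, MaxPlus.t_le_t]

/-- If `F` is a face of the toric monoid, the sum of the generators of the cone which vanish on `F`
is negative on the complement of `F`. -/
theorem exists_face_functional {F : Finset (Λ →+ ℤ)}
    (hF : ∀ u : Λ, u ∈ toricMonoid σ ↔ ∀ s ∈ F, s u ≤ 0) (N : AddSubmonoid Λ)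
    (hNle : N ≤ toricMonoid σ)
    (hface : ∀ u ∈ toricMonoid σ, ∀ u' ∈ toricMonoid σ, u + u' ∈ N → u ∈ N) :
    ∃ v₀ : Λ →+ ℤ, (∀ u ∈ N, v₀ u = 0) ∧ ∀ u ∈ toricMonoid σ, u ∉ N → v₀ u < 0 := by
  classical
  have hsum : ∀ (E : Finset (Λ →+ ℤ)) (u : Λ), (∑ s ∈ E, s) u = ∑ s ∈ E, s u := fun E u =>
    AddMonoidHom.finsetSum_apply (fun s => s) E u
  refine ⟨∑ s ∈ F.filter (fun s => ∀ u ∈ N, s u = 0), s, fun u hu => ?_, fun u hu huN => ?_⟩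
  · rw [hsum]
    exact Finset.sum_eq_zero fun s hs => (Finset.mem_filter.1 hs).2 u hu
  · rw [hsum]
    refine Finset.sum_neg' (fun s hs => (hF u).1 hu s (Finset.mem_filter.1 hs).1) ?_
    by_contra! hzero
    -- If all these generators vanish at `u`, then `u` divides a multiple of an interior point `f`
    -- of the face.
    have hex : ∀ s : Λ →+ ℤ, ∃ f ∈ N, s ∈ F → (¬ ∀ u ∈ N, s u = 0) → s f < 0 := by
      intro s
      by_cases hs : ∀ u ∈ N, s u = 0
      · exact ⟨0, N.zero_mem, fun _ h => absurd hs h⟩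
      · push Not at hs
        obtain ⟨f, hf, hsf⟩ := hs
        exact ⟨f, hf, fun hsF _ => lt_of_le_of_ne ((hF f).1 (hNle hf) s hsF) hsf⟩
    choose f hfN hfneg using hex
    let g := ∑ s ∈ F, f s
    let n : ℕ := ∑ s ∈ F, (s u).natAbs
    have hgN : g ∈ N := N.sum_mem fun s _ => hfN s
    have hmem : n • g - u ∈ toricMonoid σ := by
      refine (hF _).2 fun s hs => ?_
      rw [map_sub, map_nsmul, nsmul_eq_mul]
      by_cases hsN : ∀ u ∈ N, s u = 0
      · rw [hsN g hgN, mul_zero, zero_sub, neg_nonpos]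
        exact hzero s (Finset.mem_filter.2 ⟨hs, hsN⟩)
      · have h1 : s g ≤ -1 := by
          have h2 : s g = ∑ s' ∈ F, s (f s') := map_sum s _ _
          rw [h2, ← Finset.add_sum_erase F _ hs]
          have h3 : ∑ s' ∈ F.erase s, s (f s') ≤ 0 :=
            Finset.sum_nonpos fun s' _ => (hF _).1 (hNle (hfN s')) s hs
          have h4 := hfneg s hs hsN
          omega
        have h5 : (s u).natAbs ≤ n :=
          Finset.single_le_sum (f := fun s : Λ →+ ℤ => (s u).natAbs) (fun _ _ => Nat.zero_le _) hs
        have h6 : (n : ℤ) * s g ≤ n * (-1) := mul_le_mul_of_nonneg_left h1 (Int.natCast_nonneg n)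
        omega
    refine huN (hface u hu _ hmem ?_)
    rw [add_sub_cancel]
    exact N.nsmul_mem hgN n

/-- The closure of the cone consists of the points which are at most `1` on the toric monoid. The
finite part of such a point extends to a linear form `v`; for a functional `v₀` that defines the
face where the point is finite, `v + k v₀` lies in the cone for large `k` and tends to the point. -/
theorem mem_coneClosure_iff [Module.Finite ℤ Λ] (hσ : IsToricCone σ) (w : TropicalToric σ) :
    w ∈ coneClosure σ ↔ ∀ u, w u ≤ 1 := by
  let τ := toricTopology σ
  have hind : Topology.IsInducing (fun (w : TropicalToric σ) (u : toricMonoid σ) =>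
      tropExp (w (Multiplicative.ofAdd u))) := ⟨rfl⟩
  constructor
  · intro hw u
    have hclosed : IsClosed {w : TropicalToric σ | tropExp (w u) ≤ 1} :=
      isClosed_le ((continuous_apply u.toAdd).comp hind.continuous) continuous_const
    refine tropExp_le_one.1 (closure_minimal ?_ hclosed hw)
    rintro _ ⟨v, hv, rfl⟩
    rw [Set.mem_ofPred_eq, tropExp_le_one]
    change MaxPlus.t _ ≤ MaxPlus.t 0
    rw [MaxPlus.t_le_t]
    exact u.toAdd.2 v hv
  · intro hw
    obtain ⟨F, hF⟩ := hσ.rational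
    obtain ⟨U, hU, hdual⟩ := exists_dual_generators F
    have hM : ∀ u : Λ, u ∈ toricMonoid σ ↔ ∀ s ∈ F, s u ≤ 0 := fun u => mem_toricMonoid_iff hF
    -- the face of the toric monoid on which `w` is finite
    let N : AddSubmonoid Λ :=
      { carrier := {u | ∃ h : u ∈ toricMonoid σ, w (Multiplicative.ofAdd ⟨u, h⟩) ≠ 0}
        zero_mem' := ⟨(toricMonoid σ).zero_mem, by
          have : w (Multiplicative.ofAdd 0) = 1 := map_one w
          rw [show (⟨0, (toricMonoid σ).zero_mem⟩ : toricMonoid σ) = 0 from rfl, this]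
          exact MaxPlus.zero_ne_one.symm⟩
        add_mem' := by
          rintro a b ⟨ha, ha'⟩ ⟨hb, hb'⟩
          refine ⟨(toricMonoid σ).add_mem ha hb, ?_⟩
          have := map_mul w (Multiplicative.ofAdd ⟨a, ha⟩) (Multiplicative.ofAdd ⟨b, hb⟩)
          rw [← ofAdd_add] at this
          exact this ▸ (MaxPlus.isTotalSemifield ℝ).mul_ne_zero ha' hb' }
    have hNle : N ≤ toricMonoid σ := fun u hu => hu.1
    have hNw : ∀ u : toricMonoid σ, (u : Λ) ∈ N ↔ w (Multiplicative.ofAdd u) ≠ 0 := fun u =>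
      ⟨fun h => h.2, fun h => ⟨u.2, h⟩⟩
    have hwadd : ∀ u u' : toricMonoid σ, w (Multiplicative.ofAdd (u + u')) =
        w (Multiplicative.ofAdd u) * w (Multiplicative.ofAdd u') := fun u u' => by
      rw [ofAdd_add, map_mul]
    obtain ⟨v₀, hv₀, hv₀neg⟩ := exists_face_functional hM N hNle (by
      intro u hu u' hu' h
      refine (hNw ⟨u, hu⟩).2 fun h0 => ?_
      refine (hNw (⟨u, hu⟩ + ⟨u', hu'⟩)).1 h ?_
      rw [hwadd, h0, zero_mul])
    have hℓ : ∀ u : N, ∃ r : ℝ, w (Multiplicative.ofAdd ⟨u, hNle u.2⟩) = MaxPlus.t r := fun u =>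
      MaxPlus.exists_t u.2.2
    choose ℓ hℓ using hℓ
    obtain ⟨v, hv⟩ := AddSubmonoid.exists_extension N
      { toFun := ℓ
        map_zero' := MaxPlus.t_injective (by
          rw [← hℓ]
          exact map_one w)
        map_add' := fun a b => MaxPlus.t_injective (by
          rw [MaxPlus.t_add, ← hℓ, ← hℓ, ← hℓ, ← hwadd]
          rfl) }
    have hvN : ∀ u : toricMonoid σ, (u : Λ) ∈ N → w (Multiplicative.ofAdd u) = MaxPlus.t (v u) := by
      intro u hu
      have h1 := hv ⟨u, hu⟩
      have h2 := hℓ ⟨u, hu⟩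
      rw [h2]
      exact congrArg MaxPlus.t h1.symm
    let vk : ℕ → (Λ →+ ℝ) := fun k => v + k • (Int.castAddHom ℝ).comp v₀
    have hvk : ∀ k u, vk k u = v u + k * v₀ u := fun k u => by
      change v u + (k • (Int.castAddHom ℝ).comp v₀) u = _
      rw [AddMonoidHom.nsmul_apply, nsmul_eq_mul]
      rfl
    -- off the face the sequence tends to `-∞`
    have hlim : ∀ u : toricMonoid σ, (u : Λ) ∉ N →
        Filter.Tendsto (fun k => vk k u) Filter.atTop Filter.atBot := by
      intro u hu
      have hneg : (v₀ u : ℝ) < 0 := Int.cast_lt_zero.2 (hv₀neg u u.2 hu)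
      simp only [hvk]
      exact Filter.tendsto_atBot_add_const_left _ _
        (tendsto_natCast_atTop_atTop.atTop_mul_const_of_neg hneg)
    have hconst : ∀ u : toricMonoid σ, (u : Λ) ∈ N → ∀ k, vk k u = v u := by
      intro u hu k
      rw [hvk, hv₀ u hu, Int.cast_zero, mul_zero, add_zero]
    have hev : ∀ᶠ k in Filter.atTop, toToric σ (vk k) ∈ toToric σ '' (σ : Set (Λ →+ ℝ)) := by
      have : ∀ᶠ k in Filter.atTop, ∀ u ∈ U, vk k u ≤ 0 := by
        rw [Filter.eventually_all_finset]
        intro u hu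
        have huM : u ∈ toricMonoid σ := (hM u).2 (hU u hu)
        by_cases huN : u ∈ N
        · refine Filter.Eventually.of_forall fun k => ?_
          rw [hconst ⟨u, huM⟩ huN]
          have := hw (Multiplicative.ofAdd ⟨u, huM⟩)
          rw [hvN ⟨u, huM⟩ huN] at this
          exact MaxPlus.t_le_t.1 this
        · exact (hlim ⟨u, huM⟩ huN).eventually_le_atBot 0
      refine this.mono fun k hk => ⟨vk k, ?_, rfl⟩
      rw [SetLike.mem_coe, hF]
      exact hdual _ hk
    refine mem_closure_of_tendsto (b := Filter.atTop) (f := fun k => toToric σ (vk k)) ?_ hev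
    rw [hind.tendsto_nhds_iff, tendsto_pi_nhds]
    intro u
    change Filter.Tendsto (fun k => Real.exp (vk k u)) Filter.atTop _
    by_cases hu : (u : Λ) ∈ N
    · simp only [hconst u hu, hvN u hu, tropExp_t]
      exact tendsto_const_nhds
    · have h0 : w (Multiplicative.ofAdd u) = 0 := by
        by_contra h
        exact hu ((hNw u).2 h)
      rw [h0, tropExp_zero]
      exact Real.tendsto_exp_atBot.comp (hlim u hu)

end Toric

/-! ### Comparison of the three conditions -/

section Hahn

variable {S : Subsemiring Trop} {A : Type u} [CommSemiring A] [Algebra S A] {P P' : RingCon A}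
  {I : Type u} [LinearOrder I] [OrderBot I]

theorem JointHahnEmbedding.isTropicalization_left (E : JointHahnEmbedding (S := S) P P' I) :
    IsTropicalization (S := S) P (((MaxPlus.map (botCoeff I)).comp E.left).comp (absv P)) := by
  refine ⟨fun {a b} hab => ?_, fun s => ?_⟩
  · simp only [RingCon.ker_apply, RingHom.comp_apply, absv_eq_iff.2 hab]
  · rw [RingHom.comp_apply, RingHom.comp_apply, E.left_base, map_botCoeff_lexIncl]

theorem JointHahnEmbedding.isTropicalization_right (E : JointHahnEmbedding (S := S) P P' I) :
    IsTropicalization (S := S) P' (((MaxPlus.map (botCoeff I)).comp E.right).comp (absv P')) := by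
  refine ⟨fun {a b} hab => ?_, fun s => ?_⟩
  · simp only [RingCon.ker_apply, RingHom.comp_apply, absv_eq_iff.2 hab]
  · rw [RingHom.comp_apply, RingHom.comp_apply, E.right_base, map_botCoeff_lexIncl]

end Hahn

section Series

variable {S : Subsemiring Trop} {M : Type u} [AddCommMonoid M]
  {P P' : RingCon (AddMonoidAlgebra S M)} {φ ψ : AddMonoidAlgebra S M →+* Trop}
  {I : Type u} [LinearOrder I] [OrderBot I]

/-- The comparison of terms in a common Hahn embedding only depends on the leading coefficients.
The constants `c > 1` in `S` need not come close to `1`, but they are absorbed by taking powers. -/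
theorem JointHahnEmbedding.forall_le_iff (hS : IsSubsemifield S)
    (hP : P ∈ ContBaseInt S (AddMonoidAlgebra S M)) (hP' : P' ∈ ContBase S (AddMonoidAlgebra S M))
    (hφ : IsTropicalization (S := S) P φ) (hψ : IsTropicalization (S := S) P' ψ)
    (E : JointHahnEmbedding (S := S) P P' I) :
    (∀ c : S, (1 : Trop) < c → ∀ (u : M) (a : S),
      E.right (absv P' (AddMonoidAlgebra.single u a)) ≤
        lexIncl I c * E.left (absv P (AddMonoidAlgebra.single u a))) ↔
      ∀ u : M, ψ (AddMonoidAlgebra.single u 1) ≤ φ (AddMonoidAlgebra.single u 1) := by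
  have hleft : ∀ x, MaxPlus.map (botCoeff I) (E.left (absv P x)) = φ x := fun x =>
    DFunLike.congr_fun (E.isTropicalization_left.unique hS hP.1 hφ) x
  have hright : ∀ x, MaxPlus.map (botCoeff I) (E.right (absv P' x)) = ψ x := fun x =>
    DFunLike.congr_fun (E.isTropicalization_right.unique hS hP' hψ) x
  have hmono : ∀ {x y : LexSemifield I}, x ≤ y →
      MaxPlus.map (botCoeff I) x ≤ MaxPlus.map (botCoeff I) y := fun h =>
    le_of_leq_map _ ((MaxPlus.leq_iff_le _ _).2 h)
  constructor
  · intro h u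
    by_contra! hlt
    obtain ⟨x, hx⟩ := MaxPlus.exists_t (hφ.ne_zero hS hP.1
      (tabs_ne_zero hP u hS.isTotalSemifield.zero_ne_one.symm))
    obtain ⟨y, hy⟩ := MaxPlus.exists_t (x := ψ (AddMonoidAlgebra.single u 1)) fun h0 => by
      rw [h0] at hlt
      exact hlt.not_ge (MaxPlus.zero_le' _)
    have hxy : x < y := by rwa [hx, hy, MaxPlus.t_lt_t] at hlt
    obtain ⟨c, r, hr, hc⟩ := hS.exists_pos
    obtain ⟨n, hn⟩ := exists_nat_gt (r / (y - x))
    rw [div_lt_iff₀ (by linarith)] at hn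
    have hpow : (AddMonoidAlgebra.single (n • u) 1 : AddMonoidAlgebra S M) =
        AddMonoidAlgebra.single u 1 ^ n := by
      rw [AddMonoidAlgebra.single_pow, one_pow]
    have := hmono (h c (by rw [hc, ← MaxPlus.t_zero, MaxPlus.t_lt_t]; exact hr) (n • u) 1)
    rw [map_mul, hright, hleft, map_botCoeff_lexIncl, hpow, map_pow, map_pow, hx, hy, hc,
      MaxPlus.t_pow, MaxPlus.t_pow, ← MaxPlus.t_add, MaxPlus.t_le_t, nsmul_eq_mul,
      nsmul_eq_mul] at this
    linarith
  · intro h c hc u a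
    by_cases ha : a = 0
    · rw [ha, AddMonoidAlgebra.single_zero, map_zero, map_zero]
      exact MaxPlus.zero_le' _
    · by_contra! hlt
      have h1 := hmono hlt.le
      rw [map_mul, hright, hleft, map_botCoeff_lexIncl] at h1
      have h2 := h1.trans (hφ.single_le hψ h u a)
      obtain ⟨x, hx⟩ := MaxPlus.exists_t (hφ.ne_zero hS hP.1 (tabs_ne_zero hP u ha))
      obtain ⟨r, hr⟩ := MaxPlus.exists_t (x := (c : Trop)) fun h0 => by
        rw [h0] at hc
        exact hc.not_ge (MaxPlus.zero_le' _)
      rw [hr, ← MaxPlus.t_zero, MaxPlus.t_lt_t] at hc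
      rw [hx, hr, ← MaxPlus.t_add, MaxPlus.t_le_t] at h2
      linarith

end Series

section Toric

variable {Λ : Type u} [AddCommGroup Λ] [Module.Finite ℤ Λ] {σ : PointedCone ℝ (Λ →+ ℝ)}

/-- A point of the tropical toric variety lies in the translate of the closure of the cone by a
finite point `w` if and only if it is dominated by `w`. -/
theorem mem_translate_coneClosure_iff (hσ : IsToricCone σ) {w w' : TropicalToric σ}
    (hw : ∀ u, w u ≠ 0) : w' ∈ (fun v => w * v) '' coneClosure σ ↔ ∀ u, w' u ≤ w u := by
  constructor
  · rintro ⟨v, hv, rfl⟩ u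
    have h := (MaxPlus.leq_iff_le _ _).2 ((mem_coneClosure_iff hσ v).1 hv u)
    have h' := h.mul_left (w u)
    rwa [mul_one, MaxPlus.leq_iff_le] at h'
  · intro h
    have hex : ∀ u, ∃ r : ℝ, w u = MaxPlus.t r := fun u => MaxPlus.exists_t (hw u)
    choose r hr using hex
    let i : TropicalToric σ :=
      { toFun := fun u => MaxPlus.t (-r u)
        map_one' := by
          have : MaxPlus.t (r 1) = MaxPlus.t 0 := by rw [← hr, map_one, MaxPlus.t_zero]
          rw [MaxPlus.t_injective this, neg_zero, MaxPlus.t_zero]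
        map_mul' := fun u v => by
          have : MaxPlus.t (r (u * v)) = MaxPlus.t (r u + r v) := by
            rw [← hr, map_mul, hr, hr, MaxPlus.t_add]
          rw [MaxPlus.t_injective this, neg_add, MaxPlus.t_add] }
    have hi : ∀ u, w u * i u = 1 := fun u => by
      rw [hr]
      change MaxPlus.t (r u) * MaxPlus.t (-r u) = 1
      rw [← MaxPlus.t_add, add_neg_cancel, MaxPlus.t_zero]
    refine ⟨i * w', (mem_coneClosure_iff hσ _).2 fun u => ?_, MonoidHom.ext fun u => ?_⟩
    · have h' := ((MaxPlus.leq_iff_le _ _).2 (h u)).mul_right (i u)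
      rwa [hi, MaxPlus.leq_iff_le, mul_comm] at h'
    · rw [MonoidHom.mul_apply, MonoidHom.mul_apply, ← mul_assoc, hi, one_mul]

end Toric

end TropCont

open TropCont
theorem mainTheorem2 {Λ : Type u} [AddCommGroup Λ] [Module.Free ℤ Λ] [Module.Finite ℤ Λ]
    (σ : PointedCone ℝ (Λ →+ ℝ)) (hσ : IsToricCone σ)
    (S : Subsemiring Trop) (hS : IsSubsemifield S)
    (P : RingCon (AddMonoidAlgebra S (toricMonoid σ)))
    (hP : P ∈ ContBaseInt S (AddMonoidAlgebra S (toricMonoid σ))) :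
    -- the pullback along `ι` is a well-defined map `ι* : Cont (Cnvg P) → Cont_S S[M]`
    Set.MapsTo (fun Q : RingCon (Cnvg hP) => Q.comap (Cnvg.incl hP))
      (ContSpec (Cnvg hP) (Cnvg.topology hP))
      (ContBase S (AddMonoidAlgebra S (toricMonoid σ))) ∧
    -- which is injective
    Set.InjOn (fun Q : RingCon (Cnvg hP) => Q.comap (Cnvg.incl hP))
      (ContSpec (Cnvg hP) (Cnvg.topology hP)) ∧
    -- the map `Φ` is well defined
    (∀ P' ∈ ContBase S (AddMonoidAlgebra S (toricMonoid σ)), ∃! w, IsTropicalPoint P' w) ∧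
    ∀ P' ∈ ContBase S (AddMonoidAlgebra S (toricMonoid σ)),
      -- `κ(P)` and `κ(P')` have a common Hahn embedding over `S`
      (∃ (I : Type u) (_ : LinearOrder I) (_ : OrderBot I),
        Nonempty (JointHahnEmbedding (S := S) P P' I)) ∧
      -- and the equivalence holds for whichever one is used to compare `|m|_P` and `|m|_{P'}`
      ∀ (I : Type u) [LinearOrder I] [OrderBot I] (E : JointHahnEmbedding (S := S) P P' I),
        List.TFAE [
          P' ∈ (fun Q : RingCon (Cnvg hP) => Q.comap (Cnvg.incl hP)) ''
            ContSpec (Cnvg hP) (Cnvg.topology hP),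
          ∀ c : S, (1 : Trop) < c → ∀ (u : toricMonoid σ) (a : S),
            E.right (absv P' (AddMonoidAlgebra.single u a)) ≤
              lexIncl I c * E.left (absv P (AddMonoidAlgebra.single u a)),
          Phi P' ∈ (fun v => Phi P * v) '' coneClosure σ] := by
  refine ⟨fun Q hQ => Cnvg.comap_mem_contBase hS hQ, Cnvg.comap_injOn hS,
    fun P' hP' => existsUnique_isTropicalPoint hS hP', fun P' hP' =>
      ⟨exists_jointHahnEmbedding hS hP.1 hP', fun I _ _ E => ?_⟩⟩
  obtain ⟨φ, hφ⟩ := exists_isTropicalization hS hP.1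
  obtain ⟨ψ, hψ⟩ := exists_isTropicalization hS hP'
  have hterms := E.forall_le_iff hS hP hP' hφ hψ
  have htoric : Phi P' ∈ (fun v => Phi P * v) '' coneClosure σ ↔
      ∀ u : toricMonoid σ, ψ (AddMonoidAlgebra.single u 1) ≤ φ (AddMonoidAlgebra.single u 1) := by
    have hfin : ∀ u : Multiplicative (toricMonoid σ), Phi P u ≠ 0 := fun u => by
      have := Phi_apply hS hP.1 hφ u.toAdd
      rw [ofAdd_toAdd] at this
      rw [this]
      exact hφ.ne_zero hS hP.1 (tabs_ne_zero hP _ hS.isTotalSemifield.zero_ne_one.symm)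
    rw [mem_translate_coneClosure_iff hσ hfin]
    refine ⟨fun h u => ?_, fun h u => ?_⟩
    · rw [← Phi_apply hS hP.1 hφ, ← Phi_apply hS hP' hψ]
      exact h _
    · have := h u.toAdd
      rwa [← Phi_apply hS hP.1 hφ, ← Phi_apply hS hP' hψ] at this
  tfae_have 1 ↔ 2 :=
    ⟨fun h => hterms.2 (Cnvg.single_le_of_mem_image hS hφ hψ h),
      fun h => Cnvg.mem_image_of_single_le hS hP' hφ hψ (hterms.1 h)⟩
  tfae_have 2 ↔ 3 := hterms.trans htoric.symm
  tfae_finish
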